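/- Let $n\ge 1$, $p\ge 1$ and $q\ge 3$ be integers, let $\theta$ be a real $p\times q$ matrix and let $\Sigma$ be a real symmetric positive definite $p\times p$ matrix with symmetric positive definite square root $A$. Let $X$ be a random $p\times q$ matrix with jointly Gaussian entries, $\mathrm{E}[X_{ij}]=\theta_{ij}$ and $\mathrm{Cov}(X_{ij},X_{kl})=\Sigma_{ik}\delta_{jl}$, and let $Y$ be a random $nq\times p$ matrix with jointly Gaussian entries, $\mathrm{E}[Y_{\alpha i}]=0$ and $\mathrm{Cov}(Y_{\alpha i},Y_{\beta j})=\delta_{\alpha\beta}\Sigma_{ij}/q$. Put $S=Y^{\top}Y$ and suppose that $X$ and $S$ are independent. Let $S^{+}$ be the Moore–Penrose inverse of $S$, $R=\mathrm{rank}(S)$ and $F=\mathrm{tr}(X^{\top}S^{+}X)$. Let $r:\mathbb{R}\to[0,c_1]$ be differentiable with $|r'|\le c_2$, and set $$G=\frac{r^2(F)}{F^2}\,S^{+}XX^{\top}S^{+}S,\qquad H=AGA^{-1},\qquad \tilde Y=\sqrt q\,YA^{-1}.$$ With $X$ held fixed, regard $\tilde YH$ as a function of $\tilde Y$ (through $Y=q^{-1/2}\tilde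 YA$ and $S=Y^{\top}Y$), and write $$\mathrm{div}_{\mathrm{vec}(\tilde Y)}\mathrm{vec}(\tilde YH)=\sum_{\alpha,i}\frac{\partial(\tilde YH)_{\alpha i}}{\partial\tilde Y_{\alpha i}}.$$ Then, for all such $n$ and $p$, $qR>2$ almost surely, the partial derivatives in this sum exist almost surely, and $$\mathrm{E}\left[\left|\mathrm{div}_{\mathrm{vec}(\tilde Y)}\mathrm{vec}(\tilde YH)\right|\right]<\infty .$$ -/

import Mathlib

open MeasureTheory ProbabilityTheory
open scoped Kronecker Matrix

/-- The four Penrose equations: `B` is a Moore-Penrose inverse of the real matrix `M`. -/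
structure IsMoorePenrose {m n : Type*} [Fintype m] [Fintype n]
    (M : Matrix m n ℝ) (B : Matrix n m ℝ) : Prop where
  mul_mul_self : M * B * M = M
  self_mul_mul : B * M * B = B
  left_symm : (M * B)ᵀ = M * B
  right_symm : (B * M)ᵀ = B * M

theorem IsMoorePenrose.unique {m n : Type*} [Fintype m] [Fintype n]
    {M : Matrix m n ℝ} {B C : Matrix n m ℝ}
    (hB : IsMoorePenrose M B) (hC : IsMoorePenrose M C) : B = C := by
  have h1 : M * B = M * C := by
    calc M * B = (M * B)ᵀ := hB.left_symm.symm
      _ = ((M * C) * (M * B))ᵀ := by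
          rw [← Matrix.mul_assoc (M * C), hC.mul_mul_self]
      _ = (M * B) * (M * C) := by
          rw [Matrix.transpose_mul, hB.left_symm, hC.left_symm]
      _ = M * C := by rw [← Matrix.mul_assoc, hB.mul_mul_self]
  have h2 : B * M = C * M := by
    calc B * M = (B * M)ᵀ := hB.right_symm.symm
      _ = ((B * M) * (C * M))ᵀ := by
          rw [Matrix.mul_assoc B M (C * M), ← Matrix.mul_assoc M C M, hC.mul_mul_self]
      _ = (C * M) * (B * M) := by
          rw [Matrix.transpose_mul, hB.right_symm, hC.right_symm]
      _ = C * M := by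
          rw [Matrix.mul_assoc C M (B * M), ← Matrix.mul_assoc M B M, hB.mul_mul_self]
  calc B = B * M * B := hB.self_mul_mul.symm
    _ = C * (M * B) := by rw [h2, Matrix.mul_assoc]
    _ = C := by rw [h1, ← Matrix.mul_assoc, hC.self_mul_mul]

theorem exists_isMoorePenrose {m n : Type*} [Fintype m] [Fintype n]
    (M : Matrix m n ℝ) : ∃ B : Matrix n m ℝ, IsMoorePenrose M B := by
  classical
  have hC : (Mᵀ * M).IsHermitian := by
    simpa using Matrix.isHermitian_conjTranspose_mul_self M
  obtain ⟨U, d, hU, hD⟩ : ∃ (U : Matrix n n ℝ) (d : n → ℝ),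
      Uᵀ * U = 1 ∧ Mᵀ * M = U * Matrix.diagonal d * Uᵀ := by
    refine ⟨hC.eigenvectorUnitary, hC.eigenvalues, ?_, ?_⟩
    · have := Unitary.coe_star_mul_self hC.eigenvectorUnitary
      simpa [Matrix.star_eq_conjTranspose] using this
    · have := hC.spectral_theorem
      simpa [Unitary.conjStarAlgAut_apply, Matrix.star_eq_conjTranspose, Function.comp_def]
        using this
  have key : ∀ a b : n → ℝ, (U * Matrix.diagonal a * Uᵀ) * (U * Matrix.diagonal b * Uᵀ)
      = U * Matrix.diagonal (fun i => a i * b i) * Uᵀ := by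
    intro a b
    calc _ = U * Matrix.diagonal a * (Uᵀ * U) * Matrix.diagonal b * Uᵀ := by
          simp only [Matrix.mul_assoc]
      _ = _ := by
          rw [hU, Matrix.mul_one, Matrix.mul_assoc U, Matrix.diagonal_mul_diagonal]
  have sym : ∀ a : n → ℝ, (U * Matrix.diagonal a * Uᵀ)ᵀ = U * Matrix.diagonal a * Uᵀ := by
    intro a
    simp [Matrix.transpose_mul, Matrix.mul_assoc]
  set K : Matrix n n ℝ := U * Matrix.diagonal (fun i => (d i)⁻¹) * Uᵀ with hK
  set Q : Matrix n n ℝ := U * Matrix.diagonal (fun i => (d i)⁻¹ * d i) * Uᵀ with hQ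
  have hKC : K * (Mᵀ * M) = Q := by rw [hD, hK, key]
  have hQK : Q * K = K := by
    rw [hQ, hK, key]
    congr 3
    funext i
    by_cases h : d i = 0 <;> simp [h]
  have hCQ : (Mᵀ * M) * Q = Mᵀ * M := by
    rw [hD, hQ, key]
    congr 3
    funext i
    by_cases h : d i = 0 <;> simp [h]
  have hMQ : M * Q = M := by
    have h0 : (M * Q - M)ᴴ * (M * Q - M) = 0 := by
      have : (M * Q - M)ᴴ * (M * Q - M) = (Qᵀ - 1) * ((Mᵀ * M) * Q - Mᵀ * M) := by
        simp only [Matrix.conjTranspose_eq_transpose_of_trivial, Matrix.transpose_sub,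
          Matrix.transpose_mul, Matrix.sub_mul, Matrix.mul_sub, Matrix.one_mul, Matrix.mul_assoc]
      rw [this, hCQ, sub_self, Matrix.mul_zero]
    exact sub_eq_zero.mp (Matrix.conjTranspose_mul_self_eq_zero.mp h0)
  refine ⟨K * Mᵀ, ?_, ?_, ?_, ?_⟩
  · rw [Matrix.mul_assoc, Matrix.mul_assoc K, hKC, hMQ]
  · rw [Matrix.mul_assoc K Mᵀ M, hKC, ← Matrix.mul_assoc, hQK]
  · rw [Matrix.transpose_mul, Matrix.transpose_mul, sym, Matrix.transpose_transpose,
      Matrix.mul_assoc]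
  · rw [Matrix.mul_assoc, hKC, sym]

/-- The Moore-Penrose inverse `M⁺` of a real matrix. -/
noncomputable def pinv {m n : Type*} [Fintype m] [Fintype n]
    (M : Matrix m n ℝ) : Matrix n m ℝ :=
  Classical.choose (exists_isMoorePenrose M)

theorem pinv_spec {m n : Type*} [Fintype m] [Fintype n] (M : Matrix m n ℝ) :
    IsMoorePenrose M (pinv M) :=
  Classical.choose_spec (exists_isMoorePenrose M)

/-- The entries of a matrix, arranged as a vector of a Euclidean space. -/
def entryVec {m n : Type*} (M : Matrix m n ℝ) : EuclideanSpace ℝ (m × n) :=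
  WithLp.toLp 2 (fun ij => M ij.1 ij.2)

/-- The random matrix `Z` is matrix normal with mean `M`, row covariance `V` and column
covariance `W`: its entries are jointly Gaussian, `Z i j` has mean `M i j`, and the covariance of
`Z i j` and `Z k l` is `V i k * W j l`. -/
def IsMatrixNormal {Ω m n : Type*} [MeasurableSpace Ω] [Fintype m] [Fintype n]
    [DecidableEq m] [DecidableEq n] (P : Measure Ω) (Z : Ω → Matrix m n ℝ)
    (M : Matrix m n ℝ) (V : Matrix m m ℝ) (W : Matrix n n ℝ) : Prop :=
  HasLaw (fun ω => entryVec (Z ω)) (multivariateGaussian (entryVec M) (V ⊗ₖ W)) P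

/-- All the partial derivatives `∂ Φ i j / ∂ y i j` exist at `y`. -/
def HasDivAt {m n : Type*} [DecidableEq m] [DecidableEq n]
    (Φ : Matrix m n ℝ → Matrix m n ℝ) (y : Matrix m n ℝ) : Prop :=
  ∀ i j, LineDifferentiableAt ℝ (fun z => Φ z i j) y (Matrix.single i j 1)

/-- The divergence `∑ i j, ∂ Φ i j / ∂ y i j` of a matrix field at `y`. -/
noncomputable def matDiv {m n : Type*} [Fintype m] [Fintype n] [DecidableEq m] [DecidableEq n]
    (Φ : Matrix m n ℝ → Matrix m n ℝ) (y : Matrix m n ℝ) : ℝ :=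
  ∑ i, ∑ j, lineDeriv ℝ (fun z => Φ z i j) y (Matrix.single i j 1)

/-- `F = tr (Xᵀ S⁺ X)`. -/
noncomputable def statF {p q : ℕ} (X : Matrix (Fin p) (Fin q) ℝ) (S : Matrix (Fin p) (Fin p) ℝ) :
    ℝ :=
  (Xᵀ * pinv S * X).trace

/-- `G = (r(F)² / F²) S⁺ X Xᵀ S⁺ S`. -/
noncomputable def matG {p q : ℕ} (r : ℝ → ℝ) (X : Matrix (Fin p) (Fin q) ℝ)
    (S : Matrix (Fin p) (Fin p) ℝ) : Matrix (Fin p) (Fin p) ℝ :=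
  (r (statF X S) ^ 2 / statF X S ^ 2) • (pinv S * X * Xᵀ * pinv S * S)

/-- `H = A G A⁻¹`. -/
noncomputable def matH {p q : ℕ} (r : ℝ → ℝ) (A : Matrix (Fin p) (Fin p) ℝ)
    (X : Matrix (Fin p) (Fin q) ℝ) (S : Matrix (Fin p) (Fin p) ℝ) : Matrix (Fin p) (Fin p) ℝ :=
  A * matG r X S * A⁻¹

/-- `Ỹ = √q Y A⁻¹`. -/
noncomputable def tildeY {m : Type*} {p : ℕ} (q : ℕ) (A : Matrix (Fin p) (Fin p) ℝ)
    (Y : Matrix m (Fin p) ℝ) : Matrix m (Fin p) ℝ :=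
  Real.sqrt q • (Y * A⁻¹)

/-- `Y = q^(-1/2) Ỹ A`, the inverse of the change of variables `tildeY`. -/
noncomputable def untildeY {m : Type*} {p : ℕ} (q : ℕ) (A : Matrix (Fin p) (Fin p) ℝ)
    (y : Matrix m (Fin p) ℝ) : Matrix m (Fin p) ℝ :=
  (Real.sqrt q)⁻¹ • (y * A)

theorem untildeY_tildeY {m : Type*} {p q : ℕ} (hq : 0 < q) (A : Matrix (Fin p) (Fin p) ℝ)
    (hA : A.PosDef) (Y : Matrix m (Fin p) ℝ) : untildeY q A (tildeY q A Y) = Y := by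
  have h1 : Real.sqrt q ≠ 0 := by positivity
  have h2 : IsUnit A.det := hA.det_pos.ne'.isUnit
  rw [untildeY, tildeY, Matrix.smul_mul, smul_smul, inv_mul_cancel₀ h1, one_smul,
    Matrix.nonsing_inv_mul_cancel_right _ _ h2]

/-- The matrix field `Ỹ ↦ Ỹ H`, where `X` is held fixed and `H` depends on `Ỹ` through
`S = Yᵀ Y` and `Y = q^(-1/2) Ỹ A`. -/
noncomputable def fieldYH {m : Type*} [Fintype m] {p q : ℕ} (r : ℝ → ℝ)
    (A : Matrix (Fin p) (Fin p) ℝ) (X : Matrix (Fin p) (Fin q) ℝ)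
    (y : Matrix m (Fin p) ℝ) : Matrix m (Fin p) ℝ :=
  y * matH r A X ((untildeY q A y)ᵀ * untildeY q A y)

/-! Put V = (Y⁺)ᵀX. Then S⁺ = Y⁺(Y⁺)ᵀ, F is the squared Frobenius norm of V, and YG = φ(F)VVᵀY with
φ(t) = r(t)²/t². Almost surely Y has full rank, because a Gaussian law with positive definite
covariance gives mass zero to the zero set of a Gram determinant. Full rank is an open condition, so
Y⁺ is given near Y by an explicit formula and is differentiable along lines.

Contracting the derivative against matrix units makes A cancel and gives the divergence (nq + p - 1
- 2R)φ(F)F - 2φ'(F)tr((VᵀV)²), where the rank R enters as tr(Y⁺Y) (`matDiv_fieldYH`). As tr((VᵀV)²)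
≤ F², its modulus is at most a constant times 1/F plus 4c₁c₂ (`abs_divFormula_le`). Everything is
thus reduced to F ≠ 0 almost surely and E[1/F] < ∞.

For the inverse moment, SX = S(YᵀV), and two applications of Cauchy-Schwarz bound the squared norm
of the i-th row of SX by |Sᵢ|² tr(S) F, where Sᵢ is the i-th row of S (`sum_sq_row_le`). Hence 1/F ≤
tr(S)|Sᵢ|²/|SᵢX|². This bound involves X and S only, which are independent. Given S, the vector SᵢX
has q independent Gaussian entries of variance SᵢΣSᵢᵀ ≥ c|Sᵢ|². Since |z|⁻² ≤ ∏|zⱼ|^(-2/q) and 2/q <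
1 exactly when q ≥ 3, its inverse squared norm has mean at most a constant over |Sᵢ|², uniformly in
the mean (`lintegral_prod_rpow_neg_le`). So E[1/F] is at most a constant times E[tr S], which is
finite. No comparison of p with nq is needed for this estimate. -/

/-! ### Entrywise derivatives of curves of matrices -/

/-- Every entry of the curve of matrices `M` has a derivative at `t`, given by the entries of
`M'`. -/
def HasEntryDerivAt {m n : Type*} (M : ℝ → Matrix m n ℝ) (M' : Matrix m n ℝ) (t : ℝ) : Prop :=
  ∀ i j, HasDerivAt (fun s => M s i j) (M' i j) t

namespace HasEntryDerivAt

variable {l m n : Type*} {t : ℝ}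

theorem const (M : Matrix m n ℝ) (t : ℝ) : HasEntryDerivAt (fun _ => M) 0 t :=
  fun i j => hasDerivAt_const t (M i j)

theorem line (W D : Matrix m n ℝ) (t : ℝ) : HasEntryDerivAt (fun s => W + s • D) D t := by
  intro i j
  simpa using ((hasDerivAt_id t).mul_const (D i j)).const_add (W i j)

theorem transpose {M : ℝ → Matrix m n ℝ} {M' : Matrix m n ℝ} (h : HasEntryDerivAt M M' t) :
    HasEntryDerivAt (fun s => (M s)ᵀ) M'ᵀ t :=
  fun i j => h j i

theorem mul [Fintype m] {M : ℝ → Matrix l m ℝ} {N : ℝ → Matrix m n ℝ} {M' : Matrix l m ℝ}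
    {N' : Matrix m n ℝ} (hM : HasEntryDerivAt M M' t) (hN : HasEntryDerivAt N N' t) :
    HasEntryDerivAt (fun s => M s * N s) (M' * N t + M t * N') t := by
  intro i j
  simp only [Matrix.mul_apply, Matrix.add_apply, ← Finset.sum_add_distrib]
  exact HasDerivAt.fun_sum fun k _ => (hM i k).mul (hN k j)

theorem mul_const [Fintype m] {M : ℝ → Matrix l m ℝ} {M' : Matrix l m ℝ}
    (hM : HasEntryDerivAt M M' t) (N : Matrix m n ℝ) :
    HasEntryDerivAt (fun s => M s * N) (M' * N) t := by
  simpa using hM.mul (const N t)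

theorem smul {f : ℝ → ℝ} {f' : ℝ} {M : ℝ → Matrix m n ℝ} {M' : Matrix m n ℝ}
    (hf : HasDerivAt f f' t) (hM : HasEntryDerivAt M M' t) :
    HasEntryDerivAt (fun s => f s • M s) (f' • M t + f t • M') t :=
  fun i j => hf.mul (hM i j)

theorem trace [Fintype m] {M : ℝ → Matrix m m ℝ} {M' : Matrix m m ℝ}
    (hM : HasEntryDerivAt M M' t) : HasDerivAt (fun s => (M s).trace) M'.trace t :=
  HasDerivAt.fun_sum fun k _ => hM k k

theorem unique {M : ℝ → Matrix m n ℝ} {M' M'' : Matrix m n ℝ} (h : HasEntryDerivAt M M' t)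
    (h' : HasEntryDerivAt M M'' t) : M' = M'' :=
  Matrix.ext fun i j => (h i j).unique (h' i j)

theorem congr_of_eventuallyEq {M N : ℝ → Matrix m n ℝ} {M' : Matrix m n ℝ}
    (h : HasEntryDerivAt M M' t) (hMN : N =ᶠ[nhds t] M) : HasEntryDerivAt N M' t :=
  fun i j => (h i j).congr_of_eventuallyEq (hMN.mono fun s hs => by simp only [hs])

theorem differentiableAt_det [Fintype m] [DecidableEq m] {M : ℝ → Matrix m m ℝ}
    (h : ∀ i j, DifferentiableAt ℝ (fun s => M s i j) t) :
    DifferentiableAt ℝ (fun s => (M s).det) t := by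
  simp only [Matrix.det_apply]
  refine DifferentiableAt.fun_sum fun σ _ => ?_
  refine DifferentiableAt.fun_const_smul ?_ _
  exact DifferentiableAt.fun_finsetProd fun i _ => h _ _

/-- Cramer's rule: the entries of the adjugate are determinants of the matrix with one row replaced
by a constant one. -/
theorem differentiableAt_inv [Fintype m] [DecidableEq m] {M : ℝ → Matrix m m ℝ}
    (h : ∀ i j, DifferentiableAt ℝ (fun s => M s i j) t) (hdet : (M t).det ≠ 0) (i j : m) :
    DifferentiableAt ℝ (fun s => (M s)⁻¹ i j) t := by
  simp only [Matrix.inv_def, Matrix.smul_apply, Ring.inverse_eq_inv', smul_eq_mul,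
    Matrix.adjugate_apply]
  refine DifferentiableAt.mul ((differentiableAt_det h).inv hdet) (differentiableAt_det ?_)
  intro a b
  rcases eq_or_ne a j with rfl | hab
  · simp
  · simpa [Matrix.updateRow_ne hab] using h a b

theorem eventually_det_ne_zero [Fintype m] [DecidableEq m] {M : ℝ → Matrix m m ℝ}
    {M' : Matrix m m ℝ} (h : HasEntryDerivAt M M' t) (hdet : (M t).det ≠ 0) :
    ∀ᶠ s in nhds t, (M s).det ≠ 0 :=
  (differentiableAt_det fun i j => (h i j).differentiableAt).continuousAt.eventually_ne hdet

/-- Differentiability being known, the value comes from differentiating M⁻¹M = 1, which holds near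
t. -/
theorem inv [Fintype m] [DecidableEq m] {M : ℝ → Matrix m m ℝ} {M' : Matrix m m ℝ}
    (h : HasEntryDerivAt M M' t) (hdet : (M t).det ≠ 0) :
    HasEntryDerivAt (fun s => (M s)⁻¹) (-((M t)⁻¹ * M' * (M t)⁻¹)) t := by
  set N' : Matrix m m ℝ := Matrix.of fun i j => deriv (fun s => (M s)⁻¹ i j) t
  have hN : HasEntryDerivAt (fun s => (M s)⁻¹) N' t := fun i j =>
    (differentiableAt_inv (fun i j => (h i j).differentiableAt) hdet i j).hasDerivAt
  have h1 : HasEntryDerivAt (fun s => (M s)⁻¹ * M s) 0 t :=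
    (const 1 t).congr_of_eventuallyEq ((h.eventually_det_ne_zero hdet).mono fun s hs =>
      Matrix.nonsing_inv_mul _ hs.isUnit)
  have h2 := (hN.mul h).unique h1
  have h3 : N' = -((M t)⁻¹ * M' * (M t)⁻¹) := by
    have h4 := congrArg (· * (M t)⁻¹) (eq_neg_of_add_eq_zero_left h2)
    simpa [Matrix.mul_assoc, Matrix.mul_nonsing_inv _ hdet.isUnit] using h4
  rwa [h3] at hN

end HasEntryDerivAt

/-! ### The Moore-Penrose inverse -/

section pinv

variable {m n : Type*} [Fintype m] [Fintype n]

theorem IsMoorePenrose.pinv_eq {M : Matrix m n ℝ} {B : Matrix n m ℝ} (h : IsMoorePenrose M B) :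
    pinv M = B :=
  (pinv_spec M).unique h

theorem pinv_transpose (M : Matrix m n ℝ) : pinv Mᵀ = (pinv M)ᵀ := by
  have h := pinv_spec M
  refine IsMoorePenrose.pinv_eq ⟨?_, ?_, ?_, ?_⟩
  · rw [← Matrix.transpose_mul, ← Matrix.transpose_mul, ← Matrix.mul_assoc, h.mul_mul_self]
  · rw [← Matrix.transpose_mul, ← Matrix.transpose_mul, ← Matrix.mul_assoc, h.self_mul_mul]
  · rw [← Matrix.transpose_mul, h.right_symm, h.right_symm]
  · rw [← Matrix.transpose_mul, h.left_symm, h.left_symm]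

/-- Both products of MᵀM with the candidate collapse to the projection M⁺M. This turns every
occurrence of S⁺ into Y⁺. -/
theorem pinv_transpose_mul_self (M : Matrix m n ℝ) :
    pinv (Mᵀ * M) = pinv M * (pinv M)ᵀ := by
  have h := pinv_spec M
  have hQ : (pinv M)ᵀ * Mᵀ = M * pinv M := by rw [← Matrix.transpose_mul, h.left_symm]
  have hP : Mᵀ * (pinv M)ᵀ = pinv M * M := by rw [← Matrix.transpose_mul, h.right_symm]
  have h1 : Mᵀ * M * (pinv M * (pinv M)ᵀ) = pinv M * M := by
    rw [Matrix.mul_assoc, ← Matrix.mul_assoc M, ← hQ, Matrix.mul_assoc, ← Matrix.mul_assoc Mᵀ,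
      hP, ← Matrix.mul_assoc, h.self_mul_mul]
  have h2 : pinv M * (pinv M)ᵀ * (Mᵀ * M) = pinv M * M := by
    rw [Matrix.mul_assoc, ← Matrix.mul_assoc _ Mᵀ, hQ, ← Matrix.mul_assoc, ← Matrix.mul_assoc,
      h.self_mul_mul]
  refine IsMoorePenrose.pinv_eq ⟨?_, ?_, ?_, ?_⟩
  · rw [h1, ← hP, Matrix.mul_assoc, ← Matrix.mul_assoc _ Mᵀ, hQ, h.mul_mul_self]
  · rw [h2, ← Matrix.mul_assoc, h.self_mul_mul]
  · rw [h1, h.right_symm]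
  · rw [h2, h.right_symm]

theorem pinv_eq_of_det_ne_zero [DecidableEq n] {M : Matrix m n ℝ} (h : (Mᵀ * M).det ≠ 0) :
    pinv M = (Mᵀ * M)⁻¹ * Mᵀ := by
  have h1 : (Mᵀ * M)⁻¹ * (Mᵀ * M) = 1 := Matrix.nonsing_inv_mul _ h.isUnit
  have hs : ((Mᵀ * M)⁻¹)ᵀ = (Mᵀ * M)⁻¹ := by
    rw [Matrix.transpose_nonsing_inv]; simp
  refine IsMoorePenrose.pinv_eq ⟨?_, ?_, ?_, ?_⟩
  · rw [Matrix.mul_assoc, Matrix.mul_assoc _ Mᵀ, h1, Matrix.mul_one]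
  · rw [Matrix.mul_assoc _ Mᵀ, h1, Matrix.one_mul]
  · rw [Matrix.transpose_mul, Matrix.transpose_mul, hs, Matrix.transpose_transpose,
      Matrix.mul_assoc]
  · rw [Matrix.mul_assoc, h1, Matrix.transpose_one]

theorem pinv_eq_of_det_ne_zero' [DecidableEq m] {M : Matrix m n ℝ} (h : (M * Mᵀ).det ≠ 0) :
    pinv M = Mᵀ * (M * Mᵀ)⁻¹ := by
  have h1 := pinv_eq_of_det_ne_zero (M := Mᵀ) (by simpa using h)
  have hs : ((M * Mᵀ)⁻¹)ᵀ = (M * Mᵀ)⁻¹ := by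
    rw [Matrix.transpose_nonsing_inv]; simp
  rw [pinv_transpose, Matrix.transpose_transpose] at h1
  rw [← Matrix.transpose_transpose (pinv M), h1, Matrix.transpose_mul, hs]

variable [DecidableEq m] [DecidableEq n]

/-- A matrix of full rank, expressed by Gram determinants. -/
def FullRank (M : Matrix m n ℝ) : Prop := (Mᵀ * M).det ≠ 0 ∨ (M * Mᵀ).det ≠ 0

/-- The derivative of the Moore-Penrose inverse at `M` in the direction `D`, along matrices of
constant rank. -/
noncomputable def pinvDeriv (M D : Matrix m n ℝ) : Matrix n m ℝ :=
  -(pinv M * D * pinv M) + pinv M * (pinv M)ᵀ * Dᵀ * (1 - M * pinv M)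
    + (1 - pinv M * M) * Dᵀ * (pinv M)ᵀ * pinv M

/-- The Gram determinant stays nonzero near M, so M⁺ = (MᵀM)⁻¹Mᵀ can be differentiated directly.
Here M⁺M = 1, and the last term of `pinvDeriv` vanishes. -/
theorem hasEntryDerivAt_pinv_of_det_ne_zero {M D : Matrix m n ℝ} (h : (Mᵀ * M).det ≠ 0) :
    HasEntryDerivAt (fun t => pinv (M + t • D)) (pinvDeriv M D) 0 := by
  have hl := HasEntryDerivAt.line M D 0
  have hS := hl.transpose.mul hl
  have h0 : (((M + (0 : ℝ) • D)ᵀ * (M + (0 : ℝ) • D))).det ≠ 0 := by simpa using h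
  have hd := (hS.inv h0).mul hl.transpose
  have hev := hS.eventually_det_ne_zero h0
  have h1 := hd.congr_of_eventuallyEq (N := fun t => pinv (M + t • D))
    (hev.mono fun s hs => pinv_eq_of_det_ne_zero hs)
  have hp := pinv_eq_of_det_ne_zero h
  have hP : pinv M * M = 1 := by rw [hp, Matrix.mul_assoc, Matrix.nonsing_inv_mul _ h.isUnit]
  have hs : ((Mᵀ * M)⁻¹)ᵀ = (Mᵀ * M)⁻¹ := by
    rw [Matrix.transpose_nonsing_inv]; simp
  have hK : pinv M * (pinv M)ᵀ = (Mᵀ * M)⁻¹ := by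
    conv_lhs => rw [hp]
    rw [Matrix.transpose_mul, hs, Matrix.transpose_transpose, Matrix.mul_assoc,
      ← Matrix.mul_assoc Mᵀ, Matrix.mul_nonsing_inv _ h.isUnit, Matrix.mul_one]
  convert h1 using 1
  rw [pinvDeriv, hP, sub_self, hK]
  simp only [zero_smul, add_zero, Matrix.zero_mul, Matrix.mul_add, Matrix.add_mul, Matrix.mul_sub,
    Matrix.neg_mul, Matrix.mul_one, neg_add]
  rw [hp]
  simp only [Matrix.mul_assoc]
  abel

/-- The symmetry that reduces matrices with independent rows to matrices with independent columns.
-/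
theorem pinvDeriv_transpose (M D : Matrix m n ℝ) : pinvDeriv Mᵀ Dᵀ = (pinvDeriv M D)ᵀ := by
  have h := pinv_spec M
  have hQ : (pinv M)ᵀ * Mᵀ = M * pinv M := by rw [← Matrix.transpose_mul, h.left_symm]
  have hP : Mᵀ * (pinv M)ᵀ = pinv M * M := by rw [← Matrix.transpose_mul, h.right_symm]
  simp only [pinvDeriv, pinv_transpose, Matrix.transpose_add, Matrix.transpose_neg,
    Matrix.transpose_mul, Matrix.transpose_sub, Matrix.transpose_transpose, Matrix.transpose_one,
    hQ, hP, Matrix.mul_assoc]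
  abel

theorem FullRank.hasEntryDerivAt_pinv {M : Matrix m n ℝ} (h : FullRank M) (D : Matrix m n ℝ) :
    HasEntryDerivAt (fun t => pinv (M + t • D)) (pinvDeriv M D) 0 := by
  rcases h with h | h
  · exact hasEntryDerivAt_pinv_of_det_ne_zero h
  · have h1 := (hasEntryDerivAt_pinv_of_det_ne_zero (M := Mᵀ) (D := Dᵀ)
      (by simpa using h)).transpose
    rw [pinvDeriv_transpose, Matrix.transpose_transpose] at h1
    convert h1 using 2 with t
    rw [← pinv_transpose]
    simp

omit [DecidableEq m] in
theorem trace_pinv_mul_of_det_ne_zero {M : Matrix m n ℝ} (h : (Mᵀ * M).det ≠ 0) :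
    (pinv M * M).trace = Fintype.card n := by
  rw [pinv_eq_of_det_ne_zero h, Matrix.mul_assoc, Matrix.nonsing_inv_mul _ h.isUnit,
    Matrix.trace_one]

omit [DecidableEq n] in
theorem trace_pinv_mul_of_det_ne_zero' {M : Matrix m n ℝ} (h : (M * Mᵀ).det ≠ 0) :
    (pinv M * M).trace = Fintype.card m := by
  rw [Matrix.trace_mul_comm, pinv_eq_of_det_ne_zero' h, ← Matrix.mul_assoc,
    Matrix.mul_nonsing_inv _ h.isUnit, Matrix.trace_one]

end pinv

/-! ### Contractions over matrix units -/

section contraction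

variable {m n : Type*} [Fintype m] [Fintype n] [DecidableEq m] [DecidableEq n]

/-- The derivative of the field is linear in its direction, here a matrix unit times A. This and the
next two lemmas evaluate the shapes that occur: the direction yields a product of two traces, its
transpose a single trace. -/
theorem sum_mul_single_mul_apply (M : Matrix m m ℝ) (A N : Matrix n n ℝ) :
    ∑ i : m, ∑ j : n, (M * (Matrix.single i j (1 : ℝ) * A) * N) i j = M.trace * (A * N).trace := by
  have h : ∀ (i : m) (j : n), (M * (Matrix.single i j (1 : ℝ) * A) * N) i j = M i i * (A * N) j j := by
    intro i j
    rw [Matrix.mul_assoc, Matrix.mul_assoc, Matrix.mul_apply, Finset.sum_eq_single i]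
    · simp
    · intro b _ hb
      simp [Matrix.single_mul_apply_of_ne, hb]
    · simp
  simp only [h, Matrix.trace, Matrix.diag_apply, Finset.sum_mul_sum]

theorem sum_mul_single_transpose_mul_apply (M : Matrix m n ℝ) (A : Matrix n n ℝ)
    (N : Matrix m n ℝ) :
    ∑ i : m, ∑ j : n, (M * (Matrix.single i j (1 : ℝ) * A)ᵀ * N) i j = (M * Aᵀ * Nᵀ).trace := by
  have h : ∀ (i : m) (j : n), (M * (Matrix.single i j (1 : ℝ) * A)ᵀ * N) i j = (M * Aᵀ) i j * N i j := by
    intro i j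
    rw [Matrix.transpose_mul, Matrix.transpose_single, ← Matrix.mul_assoc, Matrix.mul_assoc,
      Matrix.mul_apply, Finset.sum_eq_single j]
    · simp
    · intro b _ hb
      simp [Matrix.single_mul_apply_of_ne, hb]
    · simp
  simp only [h, Matrix.trace, Matrix.diag_apply, Matrix.mul_apply, Matrix.transpose_apply]

theorem sum_trace_mul_single_mul (M : Matrix n m ℝ) (A : Matrix n n ℝ) (C : Matrix m n ℝ) :
    ∑ i : m, ∑ j : n, (M * (Matrix.single i j (1 : ℝ) * A)).trace * C i j = (A * M * C).trace := by
  have h : ∀ (i : m) (j : n), (M * (Matrix.single i j (1 : ℝ) * A)).trace = (A * M) j i := by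
    intro i j
    rw [← Matrix.mul_assoc, Matrix.trace_mul_comm, ← Matrix.mul_assoc, Matrix.trace_mul_single]
    simp
  simp only [h]
  rw [Finset.sum_comm]
  simp only [Matrix.trace, Matrix.diag_apply, Matrix.mul_apply (M := A * M) (N := C)]

end contraction

/-! ### The field in terms of the Moore-Penrose inverse of `Y` -/

section field

variable {m : Type*} [Fintype m] {p q : ℕ}

/-- The matrix `V = (Y⁺)ᵀ X`. -/
noncomputable def matV (X : Matrix (Fin p) (Fin q) ℝ) (W : Matrix m (Fin p) ℝ) :
    Matrix m (Fin q) ℝ :=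
  (pinv W)ᵀ * X

/-- The statistic `F`, as a function of `Y`. -/
noncomputable def normF (X : Matrix (Fin p) (Fin q) ℝ) (W : Matrix m (Fin p) ℝ) : ℝ :=
  ((matV X W)ᵀ * matV X W).trace

theorem statF_transpose_mul_self (X : Matrix (Fin p) (Fin q) ℝ) (W : Matrix m (Fin p) ℝ) :
    statF X (Wᵀ * W) = normF X W := by
  rw [statF, normF, matV, pinv_transpose_mul_self, Matrix.transpose_mul,
    Matrix.transpose_transpose]
  simp only [Matrix.mul_assoc]

theorem mul_pinv_mul_matV (X : Matrix (Fin p) (Fin q) ℝ) (W : Matrix m (Fin p) ℝ) :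
    W * pinv W * matV X W = matV X W := by
  have h := pinv_spec W
  rw [matV, ← Matrix.mul_assoc, ← h.left_symm, ← Matrix.transpose_mul, ← Matrix.mul_assoc,
    h.self_mul_mul]

/-- YS⁺ = (Y⁺)ᵀ and S⁺S = Y⁺Y. -/
theorem mul_matG (r : ℝ → ℝ) (X : Matrix (Fin p) (Fin q) ℝ) (W : Matrix m (Fin p) ℝ) :
    W * matG r X (Wᵀ * W)
      = (r (normF X W) ^ 2 / normF X W ^ 2) • (matV X W * (matV X W)ᵀ * W) := by
  have h := pinv_spec W
  have hQ : (pinv W)ᵀ * Wᵀ = W * pinv W := by rw [← Matrix.transpose_mul, h.left_symm]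
  have hB : W * pinv W * (pinv W)ᵀ = (pinv W)ᵀ := by
    rw [← h.left_symm, ← Matrix.transpose_mul, ← Matrix.mul_assoc, h.self_mul_mul]
  have hr : pinv W * (pinv W)ᵀ * (Wᵀ * W) = pinv W * W := by
    rw [Matrix.mul_assoc, ← Matrix.mul_assoc _ Wᵀ, hQ, ← Matrix.mul_assoc, ← Matrix.mul_assoc,
      h.self_mul_mul]
  rw [matG, statF_transpose_mul_self, Matrix.mul_smul, pinv_transpose_mul_self, matV,
    Matrix.transpose_mul, Matrix.transpose_transpose]
  congr 1
  calc W * (pinv W * (pinv W)ᵀ * X * Xᵀ * (pinv W * (pinv W)ᵀ) * (Wᵀ * W))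
      = (W * pinv W * (pinv W)ᵀ) * X * Xᵀ * (pinv W * (pinv W)ᵀ * (Wᵀ * W)) := by
        simp only [Matrix.mul_assoc]
    _ = _ := by rw [hB, hr]; simp only [Matrix.mul_assoc]

theorem fieldYH_eq (hq : 0 < q) (r : ℝ → ℝ) {A : Matrix (Fin p) (Fin p) ℝ} (hA : A.PosDef)
    (X : Matrix (Fin p) (Fin q) ℝ) (y : Matrix m (Fin p) ℝ) :
    fieldYH r A X y = Real.sqrt q • ((r (normF X (untildeY q A y)) ^ 2
      / normF X (untildeY q A y) ^ 2) • (matV X (untildeY q A y) * (matV X (untildeY q A y))ᵀ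
        * untildeY q A y) * A⁻¹) := by
  have h1 : Real.sqrt q ≠ 0 := by positivity
  have h2 : IsUnit A.det := hA.det_pos.ne'.isUnit
  rw [← mul_matG, fieldYH, matH]
  conv_rhs => rw [untildeY, Matrix.smul_mul, Matrix.smul_mul, smul_smul, mul_inv_cancel₀ h1,
    one_smul, ← untildeY]
  simp only [Matrix.mul_assoc]

omit [Fintype m] in
theorem untildeY_add_smul (A : Matrix (Fin p) (Fin p) ℝ) (y E : Matrix m (Fin p) ℝ) (t : ℝ) :
    untildeY q A (y + t • E) = untildeY q A y + t • untildeY q A E := by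
  simp only [untildeY, Matrix.add_mul, Matrix.smul_mul, smul_add, smul_comm t]

end field

/-! ### The divergence -/

section divergence

variable {m : Type*} [Fintype m] [DecidableEq m] {p q : ℕ}

/-- The derivative of `matV X` at `W` in the direction `D`. -/
noncomputable def matVDeriv (X : Matrix (Fin p) (Fin q) ℝ) (W D : Matrix m (Fin p) ℝ) :
    Matrix m (Fin q) ℝ :=
  -((pinv W)ᵀ * Dᵀ * matV X W) + (1 - W * pinv W) * D * (pinv W * matV X W)
    + (pinv W)ᵀ * pinv W * D * ((1 - pinv W * W) * X)

theorem transpose_pinvDeriv_mul (X : Matrix (Fin p) (Fin q) ℝ) (W D : Matrix m (Fin p) ℝ) :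
    (pinvDeriv W D)ᵀ * X = matVDeriv X W D := by
  have h := pinv_spec W
  have hQ : (pinv W)ᵀ * Wᵀ = W * pinv W := by rw [← Matrix.transpose_mul, h.left_symm]
  have hP : Wᵀ * (pinv W)ᵀ = pinv W * W := by rw [← Matrix.transpose_mul, h.right_symm]
  simp only [pinvDeriv, matVDeriv, matV, Matrix.transpose_add, Matrix.transpose_neg,
    Matrix.transpose_mul, Matrix.transpose_sub, Matrix.transpose_transpose, Matrix.transpose_one,
    hQ, hP, Matrix.mul_assoc, Matrix.add_mul, Matrix.neg_mul]

theorem FullRank.hasEntryDerivAt_matV {W : Matrix m (Fin p) ℝ} (h : FullRank W)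
    (X : Matrix (Fin p) (Fin q) ℝ) (D : Matrix m (Fin p) ℝ) :
    HasEntryDerivAt (fun t => matV X (W + t • D)) (matVDeriv X W D) 0 := by
  rw [← transpose_pinvDeriv_mul]
  exact (h.hasEntryDerivAt_pinv D).transpose.mul_const X

/-- The derivative of `r² / t²`. -/
noncomputable def shrinkDeriv (r : ℝ → ℝ) (t : ℝ) : ℝ :=
  2 * r t * deriv r t / t ^ 2 - 2 * r t ^ 2 / t ^ 3

theorem hasDerivAt_shrink {r : ℝ → ℝ} (hr : Differentiable ℝ r) {t : ℝ} (ht : t ≠ 0) :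
    HasDerivAt (fun s => r s ^ 2 / s ^ 2) (shrinkDeriv r t) t := by
  have h := ((hr t).hasDerivAt.pow 2).div ((hasDerivAt_id t).pow 2) (pow_ne_zero 2 ht)
  refine h.congr_deriv ?_
  rw [shrinkDeriv]
  simp only [Pi.pow_apply, id_eq, Nat.add_one_sub_one, pow_one, Nat.cast_ofNat, mul_one]
  field_simp

/-- The derivative of `φ(F) V Vᵀ Y` at `W` in the direction `D`. -/
noncomputable def fieldDeriv (r : ℝ → ℝ) (X : Matrix (Fin p) (Fin q) ℝ)
    (W D : Matrix m (Fin p) ℝ) : Matrix m (Fin p) ℝ :=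
  (shrinkDeriv r (normF X W) * (2 * ((matV X W)ᵀ * matVDeriv X W D).trace))
      • (matV X W * (matV X W)ᵀ * W)
    + (r (normF X W) ^ 2 / normF X W ^ 2) • (matVDeriv X W D * (matV X W)ᵀ * W
      + matV X W * (matVDeriv X W D)ᵀ * W + matV X W * (matV X W)ᵀ * D)

theorem FullRank.hasEntryDerivAt_field {r : ℝ → ℝ} (hr : Differentiable ℝ r)
    {W : Matrix m (Fin p) ℝ} (h : FullRank W) {X : Matrix (Fin p) (Fin q) ℝ}
    (hF : normF X W ≠ 0) (D : Matrix m (Fin p) ℝ) :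
    HasEntryDerivAt (fun t : ℝ => (r (normF X (W + t • D)) ^ 2 / normF X (W + t • D) ^ 2)
      • (matV X (W + t • D) * (matV X (W + t • D))ᵀ * (W + t • D))) (fieldDeriv r X W D) 0 := by
  have hV := h.hasEntryDerivAt_matV X D
  have hN : HasDerivAt (fun t : ℝ => normF X (W + t • D))
      (2 * ((matV X W)ᵀ * matVDeriv X W D).trace) 0 := by
    have h1 := (hV.transpose.mul hV).trace
    refine h1.congr_deriv ?_
    rw [Matrix.trace_add, ← Matrix.trace_transpose ((matVDeriv X W D)ᵀ * _),
      Matrix.transpose_mul, Matrix.transpose_transpose]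
    simp only [zero_smul, add_zero]
    ring
  have h0 : W + (0 : ℝ) • D = W := by simp
  have hφ := HasDerivAt.comp (h₂ := fun s => r s ^ 2 / s ^ 2) 0
    (hasDerivAt_shrink hr (t := normF X (W + (0 : ℝ) • D)) (by rwa [h0])) hN
  have h2 := HasEntryDerivAt.smul hφ ((hV.mul hV.transpose).mul (HasEntryDerivAt.line W D 0))
  simp only [h0, Function.comp_apply, Matrix.add_mul _ _ W] at h2
  exact h2

/-- Lets the factor q^(-1/2) of the direction cancel the factor √q of the field. -/
theorem fieldDeriv_smul (r : ℝ → ℝ) (X : Matrix (Fin p) (Fin q) ℝ)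
    (W D : Matrix m (Fin p) ℝ) (c : ℝ) :
    fieldDeriv r X W (c • D) = c • fieldDeriv r X W D := by
  have h : matVDeriv X W (c • D) = c • matVDeriv X W D := by
    simp [matVDeriv]
  simp only [fieldDeriv, h, Matrix.mul_smul, Matrix.smul_mul, Matrix.transpose_smul,
    Matrix.trace_smul, smul_add, smul_smul, smul_eq_mul]
  rw [show ∀ a b : ℝ, a * (2 * (c * b)) = c * (a * (2 * b)) by intros; ring]
  simp only [mul_comm c]

theorem hasLineDerivAt_fieldYH (hq : 0 < q) {r : ℝ → ℝ} (hr : Differentiable ℝ r)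
    {A : Matrix (Fin p) (Fin p) ℝ} (hA : A.PosDef) {X : Matrix (Fin p) (Fin q) ℝ}
    {Y : Matrix m (Fin p) ℝ} (h : FullRank Y) (hF : normF X Y ≠ 0) (E : Matrix m (Fin p) ℝ)
    (i : m) (j : Fin p) :
    HasLineDerivAt ℝ (fun z => fieldYH r A X z i j)
      ((fieldDeriv r X Y (E * A) * A⁻¹) i j) (tildeY q A Y) E := by
  have h1 : Real.sqrt q ≠ 0 := by positivity
  have h2 := ((h.hasEntryDerivAt_field hr hF (untildeY q A E)).mul_const A⁻¹ i j).const_mul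
    (Real.sqrt q)
  rw [show untildeY q A E = (Real.sqrt q)⁻¹ • (E * A) from rfl, fieldDeriv_smul, Matrix.smul_mul, Matrix.smul_apply, smul_eq_mul,
    mul_inv_cancel_left₀ h1] at h2
  rw [HasLineDerivAt]
  refine h2.congr_of_eventuallyEq (Filter.Eventually.of_forall fun t => ?_)
  simp only
  rw [fieldYH_eq hq r hA, untildeY_add_smul, untildeY_tildeY hq A hA, untildeY, Matrix.smul_apply,
    smul_eq_mul]

omit [DecidableEq m] in
theorem mul_one_sub_pinv_mul_self (W : Matrix m (Fin p) ℝ) : W * (1 - pinv W * W) = 0 := by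
  rw [Matrix.mul_sub, Matrix.mul_one, ← Matrix.mul_assoc, (pinv_spec W).mul_mul_self, sub_self]

omit [Fintype m] [DecidableEq m] in
theorem mul_transpose_mul_nonsing_inv {l : Type*} {A : Matrix (Fin p) (Fin p) ℝ}
    (hA : IsUnit A.det) (M : Matrix l (Fin p) ℝ) (N : Matrix m (Fin p) ℝ) :
    M * Aᵀ * (N * A⁻¹)ᵀ = M * Nᵀ := by
  rw [Matrix.transpose_mul, Matrix.mul_assoc, ← Matrix.mul_assoc Aᵀ, ← Matrix.transpose_mul,
    Matrix.nonsing_inv_mul _ hA, Matrix.transpose_one, Matrix.one_mul]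

theorem trace_mul_mul_nonsing_inv {A : Matrix (Fin p) (Fin p) ℝ} (hA : IsUnit A.det)
    (M : Matrix (Fin p) (Fin p) ℝ) : (A * (M * A⁻¹)).trace = M.trace := by
  rw [Matrix.trace_mul_comm, Matrix.mul_assoc, Matrix.nonsing_inv_mul _ hA, Matrix.mul_one]

omit [DecidableEq m] in
theorem normF_eq_trace (X : Matrix (Fin p) (Fin q) ℝ) (W : Matrix m (Fin p) ℝ) :
    (matV X W * (matV X W)ᵀ).trace = normF X W := by
  rw [normF, Matrix.trace_mul_comm]

/-- The three terms of `matVDeriv` contribute -F, (card m - tr(W⁺W))F and 0, the last because W(1 -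
W⁺W) = 0. -/
theorem sum_matVDeriv_mul {A : Matrix (Fin p) (Fin p) ℝ} (hA : IsUnit A.det)
    (X : Matrix (Fin p) (Fin q) ℝ) (W : Matrix m (Fin p) ℝ) :
    ∑ i : m, ∑ j : Fin p, (matVDeriv X W (Matrix.single i j (1 : ℝ) * A) * (matV X W)ᵀ * W * A⁻¹) i j
      = (Fintype.card m - 1 - (pinv W * W).trace) * normF X W := by
  have hB : (pinv W)ᵀ * Wᵀ = W * pinv W := by
    rw [← Matrix.transpose_mul, (pinv_spec W).left_symm]
  have hV := mul_pinv_mul_matV X W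
  have h0 := mul_one_sub_pinv_mul_self W
  have hF := normF_eq_trace X W
  set V := matV X W with hVdef
  have h1 := sum_mul_single_transpose_mul_apply (pinv W)ᵀ A (V * Vᵀ * W * A⁻¹)
  have h2 := sum_mul_single_mul_apply (1 - W * pinv W) A (pinv W * V * Vᵀ * W * A⁻¹)
  have h3 := sum_mul_single_mul_apply ((pinv W)ᵀ * pinv W) A
    ((1 - pinv W * W) * X * Vᵀ * W * A⁻¹)
  have e1 : ((pinv W)ᵀ * (V * Vᵀ * W)ᵀ).trace = normF X W := by
    rw [Matrix.transpose_mul, ← Matrix.mul_assoc, hB, Matrix.transpose_mul,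
      Matrix.transpose_transpose, ← Matrix.mul_assoc, hV, hF]
  have e2 : (pinv W * V * Vᵀ * W).trace = normF X W := by
    rw [Matrix.trace_mul_comm, ← Matrix.mul_assoc, ← Matrix.mul_assoc, hV, hF]
  have e3 : ((1 - pinv W * W) * X * Vᵀ * W).trace = 0 := by
    rw [Matrix.trace_mul_comm, ← Matrix.mul_assoc, ← Matrix.mul_assoc, h0]
    simp
  rw [mul_transpose_mul_nonsing_inv hA, e1] at h1
  rw [trace_mul_mul_nonsing_inv hA, e2, Matrix.trace_sub, Matrix.trace_one,
    Matrix.trace_mul_comm W] at h2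
  rw [trace_mul_mul_nonsing_inv hA, e3, mul_zero] at h3
  have h4 : ∀ (i : m) (j : Fin p), (matVDeriv X W (Matrix.single i j (1 : ℝ) * A) * Vᵀ * W * A⁻¹) i j
      = -((pinv W)ᵀ * (Matrix.single i j (1 : ℝ) * A)ᵀ * (V * Vᵀ * W * A⁻¹)) i j
        + ((1 - W * pinv W) * (Matrix.single i j (1 : ℝ) * A)
          * (pinv W * V * Vᵀ * W * A⁻¹) : Matrix m (Fin p) ℝ) i j
        + ((pinv W)ᵀ * pinv W * (Matrix.single i j (1 : ℝ) * A)
          * ((1 - pinv W * W) * X * Vᵀ * W * A⁻¹) : Matrix m (Fin p) ℝ) i j := by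
    intro i j
    rw [← Matrix.neg_apply, ← Matrix.add_apply, ← Matrix.add_apply, matVDeriv, ← hVdef]
    simp only [Matrix.add_mul, Matrix.neg_mul, Matrix.mul_assoc]
  simp only [h4, Finset.sum_add_distrib, Finset.sum_neg_distrib, h1, h2, h3]
  ring

/-- Only the first term of `matVDeriv` survives: the second is killed by (1 - WW⁺)W = 0, the third
by (1 - W⁺W)W⁺ = 0. -/
theorem sum_mul_matVDeriv_transpose_mul {A : Matrix (Fin p) (Fin p) ℝ} (hA : IsUnit A.det)
    (X : Matrix (Fin p) (Fin q) ℝ) (W : Matrix m (Fin p) ℝ) :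
    ∑ i : m, ∑ j : Fin p, (matV X W * (matVDeriv X W (Matrix.single i j (1 : ℝ) * A))ᵀ * W * A⁻¹) i j
      = -(pinv W * W).trace * normF X W := by
  have hQ := (pinv_spec W).left_symm
  have hP := (pinv_spec W).right_symm
  have hQW : (1 - W * pinv W) * W = 0 := by
    rw [Matrix.sub_mul, Matrix.one_mul, (pinv_spec W).mul_mul_self, sub_self]
  have hF := normF_eq_trace X W
  set V := matV X W with hVdef
  have h1 := sum_mul_single_mul_apply (V * Vᵀ) A (pinv W * W * A⁻¹)
  have h3 := sum_mul_single_transpose_mul_apply (V * Xᵀ * (1 - pinv W * W)) A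
    ((pinv W)ᵀ * pinv W * W * A⁻¹)
  have e3 : (V * Xᵀ * (1 - pinv W * W) * ((pinv W)ᵀ * pinv W * W)ᵀ).trace = 0 := by
    have : (1 - pinv W * W) * ((pinv W)ᵀ * pinv W * W)ᵀ = 0 := by
      rw [Matrix.mul_assoc, Matrix.transpose_mul, hP, Matrix.transpose_transpose,
        ← Matrix.mul_assoc, Matrix.sub_mul, Matrix.one_mul, ← Matrix.mul_assoc,
        (pinv_spec W).self_mul_mul, sub_self, Matrix.zero_mul]
    rw [Matrix.mul_assoc, this, Matrix.mul_zero, Matrix.trace_zero]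
  rw [trace_mul_mul_nonsing_inv hA, hF] at h1
  rw [mul_transpose_mul_nonsing_inv hA, e3] at h3
  have h4 : ∀ (i : m) (j : Fin p), (V * (matVDeriv X W (Matrix.single i j (1 : ℝ) * A))ᵀ * W * A⁻¹) i j
      = -(V * Vᵀ * (Matrix.single i j (1 : ℝ) * A) * (pinv W * W * A⁻¹)) i j
        + (V * Xᵀ * (1 - pinv W * W) * (Matrix.single i j (1 : ℝ) * A)ᵀ
          * ((pinv W)ᵀ * pinv W * W * A⁻¹) : Matrix m (Fin p) ℝ) i j := by
    intro i j
    have e : (matVDeriv X W (Matrix.single i j (1 : ℝ) * A))ᵀ * W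
        = -(Vᵀ * (Matrix.single i j (1 : ℝ) * A) * (pinv W * W))
          + Xᵀ * (1 - pinv W * W) * (Matrix.single i j (1 : ℝ) * A)ᵀ
            * ((pinv W)ᵀ * pinv W * W) := by
      have e2 : ((1 - W * pinv W) * (Matrix.single i j (1 : ℝ) * A) * (pinv W * V))ᵀ * W = 0 := by
        rw [Matrix.mul_assoc, Matrix.transpose_mul, Matrix.transpose_sub, hQ,
          Matrix.transpose_one, Matrix.mul_assoc, hQW, Matrix.mul_zero]
      rw [matVDeriv, Matrix.transpose_add, Matrix.transpose_add, Matrix.add_mul, Matrix.add_mul,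
        ← hVdef, e2, add_zero]
      simp only [Matrix.transpose_neg, Matrix.transpose_mul, Matrix.transpose_transpose,
        Matrix.transpose_sub, hP, Matrix.transpose_one, Matrix.neg_mul, Matrix.mul_assoc]
    rw [← Matrix.neg_apply, ← Matrix.add_apply, Matrix.mul_assoc V, e]
    simp only [Matrix.mul_add, Matrix.add_mul, Matrix.neg_mul, Matrix.mul_neg, Matrix.mul_assoc]
  simp only [h4, Finset.sum_add_distrib, Finset.sum_neg_distrib, h1, h3]
  ring

/-- The derivative of F is twice the pairing of the direction with M below. The sum becomes
tr(WMVVᵀ), where WW⁺V = V and W(1 - W⁺W) = 0 leave one term. -/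
theorem sum_trace_mul_matVDeriv_mul {A : Matrix (Fin p) (Fin p) ℝ} (hA : IsUnit A.det)
    (X : Matrix (Fin p) (Fin q) ℝ) (W : Matrix m (Fin p) ℝ) :
    ∑ i : m, ∑ j : Fin p, ((matV X W)ᵀ * matVDeriv X W (Matrix.single i j (1 : ℝ) * A)).trace
        * (matV X W * (matV X W)ᵀ * W * A⁻¹) i j
      = -((matV X W)ᵀ * matV X W * ((matV X W)ᵀ * matV X W)).trace := by
  have hQ := (pinv_spec W).left_symm
  have hV := mul_pinv_mul_matV X W
  have h0 := mul_one_sub_pinv_mul_self W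
  set V := matV X W with hVdef
  have hVQ : Vᵀ * (1 - W * pinv W) = 0 := by
    have := congrArg Matrix.transpose hV
    rw [Matrix.transpose_mul, hQ] at this
    rw [Matrix.mul_sub, this, Matrix.mul_one, sub_self]
  set M : Matrix (Fin p) m ℝ := (1 - pinv W * W) * X * Vᵀ * (pinv W)ᵀ * pinv W
    - pinv W * V * Vᵀ with hM
  have h1 := sum_trace_mul_single_mul M A (V * Vᵀ * W * A⁻¹)
  have h2 : ∀ (i : m) (j : Fin p), (Vᵀ * matVDeriv X W (Matrix.single i j (1 : ℝ) * A)).trace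
      = (M * (Matrix.single i j (1 : ℝ) * A)).trace := by
    intro i j
    have e1 : (Vᵀ * ((pinv W)ᵀ * (Matrix.single i j (1 : ℝ) * A)ᵀ * V)).trace
        = (pinv W * V * Vᵀ * (Matrix.single i j (1 : ℝ) * A)).trace := by
      rw [← Matrix.trace_transpose, Matrix.mul_assoc (pinv W * V),
        Matrix.trace_mul_comm (pinv W * V)]
      generalize Matrix.single i j (1 : ℝ) * A = D
      simp only [Matrix.transpose_mul, Matrix.transpose_transpose, Matrix.mul_assoc]
    have e2 : Vᵀ * ((1 - W * pinv W) * (Matrix.single i j (1 : ℝ) * A) * (pinv W * V)) = 0 := by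
      rw [Matrix.mul_assoc (1 - W * pinv W), ← Matrix.mul_assoc, hVQ, Matrix.zero_mul]
    have e3 : (Vᵀ * ((pinv W)ᵀ * pinv W * (Matrix.single i j (1 : ℝ) * A)
        * ((1 - pinv W * W) * X))).trace
        = ((1 - pinv W * W) * X * Vᵀ * (pinv W)ᵀ * pinv W
          * (Matrix.single i j (1 : ℝ) * A)).trace := by
      rw [← Matrix.mul_assoc, Matrix.trace_mul_comm]
      simp only [Matrix.mul_assoc]
    rw [matVDeriv, ← hVdef, Matrix.mul_add, Matrix.mul_add, e2, add_zero, Matrix.mul_neg,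
      Matrix.trace_add, Matrix.trace_neg, e1, e3, hM, Matrix.sub_mul _ _ (_ * A), Matrix.trace_sub]
    ring
  simp only [h2, h1]
  rw [Matrix.mul_assoc A, ← Matrix.mul_assoc M, trace_mul_mul_nonsing_inv hA,
    ← Matrix.mul_assoc M, Matrix.trace_mul_comm, hM, Matrix.sub_mul, Matrix.mul_sub]
  simp only [← Matrix.mul_assoc, h0, hV]
  simp only [Matrix.zero_mul, zero_sub, Matrix.trace_neg]
  rw [Matrix.mul_assoc, Matrix.mul_assoc, Matrix.trace_mul_comm]
  simp only [Matrix.mul_assoc]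

/-- The divergence of the field, in terms of `F`, `Vᵀ V` and the rank `ρ` of `Y`. -/
noncomputable def divFormula (r : ℝ → ℝ) (ρ : ℝ) (X : Matrix (Fin p) (Fin q) ℝ)
    (W : Matrix m (Fin p) ℝ) : ℝ :=
  (Fintype.card m + p - 1 - 2 * ρ) * (r (normF X W) ^ 2 / normF X W ^ 2 * normF X W)
    - 2 * shrinkDeriv r (normF X W)
      * ((matV X W)ᵀ * matV X W * ((matV X W)ᵀ * matV X W)).trace

theorem hasDivAt_fieldYH (hq : 0 < q) {r : ℝ → ℝ} (hr : Differentiable ℝ r)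
    {A : Matrix (Fin p) (Fin p) ℝ} (hA : A.PosDef) {X : Matrix (Fin p) (Fin q) ℝ}
    {Y : Matrix m (Fin p) ℝ} (h : FullRank Y) (hF : normF X Y ≠ 0) :
    HasDivAt (fieldYH r A X) (tildeY q A Y) := fun i j =>
  (hasLineDerivAt_fieldYH hq hr hA h hF _ i j).lineDifferentiableAt

theorem matDiv_fieldYH (hq : 0 < q) {r : ℝ → ℝ} (hr : Differentiable ℝ r)
    {A : Matrix (Fin p) (Fin p) ℝ} (hA : A.PosDef) {X : Matrix (Fin p) (Fin q) ℝ}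
    {Y : Matrix m (Fin p) ℝ} (h : FullRank Y) (hF : normF X Y ≠ 0) :
    matDiv (fieldYH r A X) (tildeY q A Y) = divFormula r (pinv Y * Y).trace X Y := by
  have hAu : IsUnit A.det := hA.det_pos.ne'.isUnit
  simp only [matDiv, (hasLineDerivAt_fieldYH hq hr hA h hF _ _ _).lineDeriv]
  have h1 := sum_matVDeriv_mul hAu X Y
  have h2 := sum_mul_matVDeriv_transpose_mul hAu X Y
  have h3 := sum_trace_mul_matVDeriv_mul hAu X Y
  -- Differentiating the last factor Y contributes pF, the trace of the identity times F.
  have h4 := sum_mul_single_mul_apply (matV X Y * (matV X Y)ᵀ) A A⁻¹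
  rw [Matrix.mul_nonsing_inv _ hAu, Matrix.trace_one, Matrix.trace_mul_comm, ← normF,
    Fintype.card_fin] at h4
  have h5 : ∀ (i : m) (j : Fin p), (fieldDeriv r X Y (Matrix.single i j (1 : ℝ) * A) * A⁻¹) i j
      = 2 * shrinkDeriv r (normF X Y)
          * (((matV X Y)ᵀ * matVDeriv X Y (Matrix.single i j (1 : ℝ) * A)).trace
          * (matV X Y * (matV X Y)ᵀ * Y * A⁻¹) i j)
        + (r (normF X Y) ^ 2 / normF X Y ^ 2)
          * ((matVDeriv X Y (Matrix.single i j (1 : ℝ) * A) * (matV X Y)ᵀ * Y * A⁻¹) i j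
          + (matV X Y * (matVDeriv X Y (Matrix.single i j (1 : ℝ) * A))ᵀ * Y * A⁻¹) i j
          + (matV X Y * (matV X Y)ᵀ * (Matrix.single i j (1 : ℝ) * A) * A⁻¹) i j) := by
    intro i j
    simp only [fieldDeriv, Matrix.add_mul, Matrix.smul_mul, Matrix.add_apply, Matrix.smul_apply,
      smul_eq_mul]
    ring
  simp only [h5, Finset.sum_add_distrib, ← Finset.mul_sum, h1, h2, h3, h4, divFormula]
  ring

end divergence

/-! ### Bounds for the divergence and for `F` -/

section bounds

variable {m : Type*} [Fintype m] {p q : ℕ}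

theorem normF_eq_sum (X : Matrix (Fin p) (Fin q) ℝ) (W : Matrix m (Fin p) ℝ) :
    normF X W = ∑ j, ∑ a, matV X W a j ^ 2 := by
  simp only [normF, Matrix.trace, Matrix.diag_apply, Matrix.mul_apply, Matrix.transpose_apply, sq]

theorem normF_nonneg (X : Matrix (Fin p) (Fin q) ℝ) (W : Matrix m (Fin p) ℝ) :
    0 ≤ normF X W := by
  rw [normF_eq_sum]
  positivity

theorem trace_sq_gram_eq_sum (V : Matrix m (Fin q) ℝ) :
    (Vᵀ * V * (Vᵀ * V)).trace = ∑ j, ∑ k, (∑ a, V a j * V a k) ^ 2 := by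
  simp only [Matrix.trace, Matrix.diag_apply, Matrix.mul_apply (M := Vᵀ * V)]
  refine Finset.sum_congr rfl fun j _ => Finset.sum_congr rfl fun k _ => ?_
  simp only [Matrix.mul_apply, Matrix.transpose_apply, sq]
  congr 1
  exact Finset.sum_congr rfl fun a _ => mul_comm _ _

/-- Cauchy-Schwarz for each pair of columns of V. -/
theorem abs_trace_sq_gram_le (X : Matrix (Fin p) (Fin q) ℝ) (W : Matrix m (Fin p) ℝ) :
    |((matV X W)ᵀ * matV X W * ((matV X W)ᵀ * matV X W)).trace| ≤ normF X W ^ 2 := by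
  rw [trace_sq_gram_eq_sum, normF_eq_sum, abs_of_nonneg (by positivity), sq (∑ j, _),
    Finset.sum_mul_sum]
  exact Finset.sum_le_sum fun j _ => Finset.sum_le_sum fun k _ =>
    Finset.sum_mul_sq_le_sq_mul_sq _ _ _

/-- φ(F)F ≤ c₁²/F and |φ'(F)| ≤ 2c₁c₂/F² + 2c₁²/F³; the factor F² from the trace leaves only 1/F and
a constant. -/
theorem abs_divFormula_le {r : ℝ → ℝ} {c₁ c₂ : ℝ} (hr : ∀ t, 0 ≤ r t ∧ r t ≤ c₁)
    (hr' : ∀ t, |deriv r t| ≤ c₂) (ρ : ℝ) {X : Matrix (Fin p) (Fin q) ℝ}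
    {W : Matrix m (Fin p) ℝ} (hF : normF X W ≠ 0) :
    |divFormula r ρ X W| ≤ (|Fintype.card m + p - 1 - 2 * ρ| + 4) * c₁ ^ 2 * (normF X W)⁻¹
      + 4 * c₁ * c₂ := by
  have hF0 : 0 < normF X W := lt_of_le_of_ne (normF_nonneg X W) hF.symm
  have hT := abs_trace_sq_gram_le X W
  obtain ⟨h0, h1⟩ := hr (normF X W)
  have h2 := hr' (normF X W)
  have hc₂ : 0 ≤ c₂ := (abs_nonneg _).trans h2
  have hc₁ : 0 ≤ c₁ := h0.trans h1
  rw [divFormula, shrinkDeriv]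
  set F := normF X W
  set T := ((matV X W)ᵀ * matV X W * ((matV X W)ᵀ * matV X W)).trace
  set κ : ℝ := Fintype.card m + p - 1 - 2 * ρ
  have hsq : r F ^ 2 ≤ c₁ ^ 2 := pow_le_pow_left₀ h0 h1 2
  have e1 : |κ * (r F ^ 2 / F ^ 2 * F)| ≤ |κ| * (c₁ ^ 2 * F⁻¹) := by
    rw [abs_mul, abs_of_nonneg (a := r F ^ 2 / F ^ 2 * F) (by positivity)]
    have : r F ^ 2 / F ^ 2 * F = r F ^ 2 * F⁻¹ := by field_simp
    rw [this]
    gcongr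
  have e2 : |2 * (2 * r F * deriv r F / F ^ 2 - 2 * r F ^ 2 / F ^ 3)|
      ≤ 4 * c₁ * c₂ / F ^ 2 + 4 * c₁ ^ 2 / F ^ 3 := by
    rw [abs_mul, abs_two]
    have a1 : |2 * r F * deriv r F / F ^ 2| ≤ 2 * c₁ * c₂ / F ^ 2 := by
      rw [abs_div, abs_mul, abs_of_nonneg (a := 2 * r F) (by positivity),
        abs_of_nonneg (a := F ^ 2) (by positivity)]
      gcongr
    have a2 : |2 * r F ^ 2 / F ^ 3| ≤ 2 * c₁ ^ 2 / F ^ 3 := by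
      rw [abs_of_nonneg (by positivity)]
      gcongr
    calc _ ≤ 2 * (2 * c₁ * c₂ / F ^ 2 + 2 * c₁ ^ 2 / F ^ 3) := by
          gcongr
          exact (abs_sub _ _).trans (add_le_add a1 a2)
      _ = _ := by ring
  calc |κ * (r F ^ 2 / F ^ 2 * F) - 2 * (2 * r F * deriv r F / F ^ 2 - 2 * r F ^ 2 / F ^ 3) * T|
      ≤ |κ| * (c₁ ^ 2 * F⁻¹) + (4 * c₁ * c₂ / F ^ 2 + 4 * c₁ ^ 2 / F ^ 3) * F ^ 2 := by
        refine (abs_sub _ _).trans (add_le_add e1 ?_)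
        rw [abs_mul]
        exact mul_le_mul e2 hT (abs_nonneg _) (by positivity)
    _ = _ := by field_simp; ring

/-- WᵀV = W⁺WX is the projection of X to the row space of W, and WᵀW annihilates the rest. -/
theorem transpose_mul_self_mul_eq (X : Matrix (Fin p) (Fin q) ℝ) (W : Matrix m (Fin p) ℝ) :
    Wᵀ * W * X = Wᵀ * W * (Wᵀ * matV X W) := by
  have hP : Wᵀ * (pinv W)ᵀ = pinv W * W := by
    rw [← Matrix.transpose_mul, (pinv_spec W).right_symm]
  rw [matV, ← Matrix.mul_assoc Wᵀ _ X, hP, ← Matrix.mul_assoc, Matrix.mul_assoc Wᵀ W (_ * W),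
    ← Matrix.mul_assoc W, (pinv_spec W).mul_mul_self]

theorem sum_sq_row_le (X : Matrix (Fin p) (Fin q) ℝ) (W : Matrix m (Fin p) ℝ) (i : Fin p) :
    ∑ j, (Wᵀ * W * X) i j ^ 2
      ≤ (∑ k, (Wᵀ * W) i k ^ 2) * ((Wᵀ * W).trace * normF X W) := by
  have hT : (Wᵀ * W).trace = ∑ k, ∑ a, W a k ^ 2 := by
    simp only [Matrix.trace, Matrix.diag_apply, Matrix.mul_apply, Matrix.transpose_apply, sq]
  rw [transpose_mul_self_mul_eq, hT, normF_eq_sum, Finset.sum_mul_sum, Finset.sum_comm,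
    Finset.mul_sum]
  refine Finset.sum_le_sum fun j _ => ?_
  rw [Matrix.mul_apply]
  refine (Finset.sum_mul_sq_le_sq_mul_sq _ _ _).trans ?_
  gcongr with k
  rw [Matrix.mul_apply]
  exact Finset.sum_mul_sq_le_sq_mul_sq _ _ _

end bounds

/-! ### Measurability of matrix functions, entry by entry -/

/-- Every entry of the random matrix `M` is almost everywhere measurable. -/
def EntryAEMeasurable {Ω m n : Type*} [MeasurableSpace Ω] (M : Ω → Matrix m n ℝ)
    (P : Measure Ω) : Prop :=
  ∀ i j, AEMeasurable (fun ω => M ω i j) P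

namespace EntryAEMeasurable

variable {Ω l m n : Type*} [MeasurableSpace Ω] {P : Measure Ω}

theorem transpose {M : Ω → Matrix m n ℝ} (h : EntryAEMeasurable M P) :
    EntryAEMeasurable (fun ω => (M ω)ᵀ) P :=
  fun i j => h j i

theorem mul [Fintype m] {M : Ω → Matrix l m ℝ} {N : Ω → Matrix m n ℝ}
    (hM : EntryAEMeasurable M P) (hN : EntryAEMeasurable N P) :
    EntryAEMeasurable (fun ω => M ω * N ω) P := by
  intro i j
  simp only [Matrix.mul_apply]
  exact Finset.aemeasurable_fun_sum _ fun k _ => (hM i k).mul (hN k j)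

theorem trace [Fintype m] {M : Ω → Matrix m m ℝ} (h : EntryAEMeasurable M P) :
    AEMeasurable (fun ω => (M ω).trace) P :=
  Finset.aemeasurable_fun_sum _ fun k _ => h k k

theorem det [Fintype m] [DecidableEq m] {M : Ω → Matrix m m ℝ} (h : EntryAEMeasurable M P) :
    AEMeasurable (fun ω => (M ω).det) P := by
  simp only [Matrix.det_apply]
  exact Finset.aemeasurable_fun_sum _ fun σ _ =>
    (Finset.aemeasurable_fun_prod _ fun i _ => h _ _).const_smul _

theorem inv [Fintype m] [DecidableEq m] {M : Ω → Matrix m m ℝ} (h : EntryAEMeasurable M P) :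
    EntryAEMeasurable (fun ω => (M ω)⁻¹) P := by
  intro i j
  simp only [Matrix.inv_def, Matrix.smul_apply, Ring.inverse_eq_inv', smul_eq_mul,
    Matrix.adjugate_apply]
  refine h.det.inv.mul (det fun a b => ?_)
  rcases eq_or_ne a j with rfl | hab
  · simp
  · simpa [Matrix.updateRow_ne hab] using h a b

theorem congr {M N : Ω → Matrix m n ℝ} (h : EntryAEMeasurable M P) (hMN : M =ᵐ[P] N) :
    EntryAEMeasurable N P :=
  fun i j => (h i j).congr (hMN.mono fun ω hω => by simp only [hω])

end EntryAEMeasurable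

theorem aemeasurable_divFormula {Ω m : Type*} [MeasurableSpace Ω] {P : Measure Ω} [Fintype m]
    {p q : ℕ} {r : ℝ → ℝ} (hr : Differentiable ℝ r) (ρ : ℝ) {X : Ω → Matrix (Fin p) (Fin q) ℝ}
    {W : Ω → Matrix m (Fin p) ℝ} (hX : EntryAEMeasurable X P)
    (hW : EntryAEMeasurable (fun ω => pinv (W ω)) P) :
    AEMeasurable (fun ω => divFormula r ρ (X ω) (W ω)) P := by
  have hV : EntryAEMeasurable (fun ω => matV (X ω) (W ω)) P := hW.transpose.mul hX
  have hG := hV.transpose.mul hV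
  have hF : AEMeasurable (fun ω => normF (X ω) (W ω)) P := hG.trace
  have hrm : Measurable r := hr.continuous.measurable
  have hrF := hrm.comp_aemeasurable hF
  -- The derivative of r need not be continuous, but a derivative is always measurable.
  have hdF := (measurable_deriv r).comp_aemeasurable hF
  have hT := (hG.mul hG).trace
  simp only [Function.comp_def] at hrF hdF
  simp only [divFormula, shrinkDeriv]
  fun_prop

/-! ### Negative moments of Gaussian variables -/

section moments

open scoped ENNReal

theorem lintegral_Icc_rpow_neg_lt_top {a : ℝ} (ha : a < 1) :
    ∫⁻ x in Set.Icc (-1 : ℝ) 1, ‖x‖ₑ ^ (-a) < ∞ := by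
  have h1 : IntegrableOn (fun x : ℝ => ‖x‖ ^ (-a)) (Metric.ball 0 2) :=
    integrableOn_ball_of_norm_le_rpow (C := 1) (by simp) (by simpa using ha)
      (ae_of_all _ fun x => by
        rw [one_mul, Real.norm_of_nonneg (Real.rpow_nonneg (norm_nonneg x) _)])
      (measurable_norm.pow_const _).aestronglyMeasurable
  have h2 : IntegrableOn (fun x : ℝ => ‖x‖ ^ (-a)) (Set.Icc (-1) 1) := h1.mono_set fun x hx => by
    rw [mem_ball_zero_iff, Real.norm_eq_abs, abs_lt]
    constructor <;> linarith [hx.1, hx.2]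
  refine lt_of_eq_of_lt (lintegral_congr_ae ?_) h2.hasFiniteIntegral
  -- The origin is removed because the real and the extended negative powers can differ there.
  filter_upwards [compl_mem_ae_iff.2 (measure_singleton (0 : ℝ))] with x hx
  rw [← enorm_norm x, Real.enorm_of_nonneg (norm_nonneg x),
    Real.enorm_of_nonneg (Real.rpow_nonneg (norm_nonneg x) _),
    ENNReal.ofReal_rpow_of_pos (norm_pos_iff.2 hx)]

theorem gaussianPDF_one_le_one (μ x : ℝ) : gaussianPDF μ 1 x ≤ 1 := by
  rw [gaussianPDF, gaussianPDFReal, ENNReal.ofReal_le_one]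
  have h1 : (√(2 * Real.pi * (1 : NNReal)))⁻¹ ≤ 1 := by
    apply inv_le_one_of_one_le₀
    rw [Real.one_le_sqrt]
    have := Real.pi_gt_three
    push_cast
    linarith
  have h2 : Real.exp (-(x - μ) ^ 2 / (2 * (1 : NNReal))) ≤ 1 := by
    rw [Real.exp_le_one_iff]
    push_cast
    nlinarith [sq_nonneg (x - μ)]
  exact mul_le_one₀ h1 (Real.exp_nonneg _) h2

/-- The density is at most 1 on [-1, 1] and the integrand is at most 1 outside, so the bound does
not depend on the mean. -/
theorem lintegral_rpow_neg_gaussianReal_one_le {a : ℝ} (ha : 0 < a) (μ : ℝ) :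
    ∫⁻ x, ‖x‖ₑ ^ (-a) ∂(gaussianReal μ 1)
      ≤ (∫⁻ x in Set.Icc (-1 : ℝ) 1, ‖x‖ₑ ^ (-a)) + 1 := by
  have hm : Measurable fun x : ℝ => ‖x‖ₑ ^ (-a) := by fun_prop
  rw [gaussianReal_of_var_ne_zero μ one_ne_zero,
    lintegral_withDensity_eq_lintegral_mul _ (measurable_gaussianPDF μ 1) hm,
    ← lintegral_add_compl _ (measurableSet_Icc (a := (-1 : ℝ)) (b := 1))]
  gcongr with x
  · simp only [Pi.mul_apply]
    exact mul_le_of_le_one_left zero_le (gaussianPDF_one_le_one μ x)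
  · rw [← lintegral_gaussianPDF_eq_one μ (one_ne_zero (α := NNReal))]
    refine (setLIntegral_mono_ae' measurableSet_Icc.compl (ae_of_all _ fun x hx => ?_)).trans
      (setLIntegral_le_lintegral _ _)
    simp only [Pi.mul_apply]
    refine mul_le_of_le_one_right zero_le ?_
    rw [ENNReal.rpow_neg, ENNReal.inv_le_one]
    refine ENNReal.one_le_rpow (le_of_lt ?_) ha
    have hx' : 1 < |x| := by
      rw [Set.mem_compl_iff, Set.mem_Icc, ← abs_le, not_le] at hx
      exact hx
    rw [← enorm_norm x, Real.enorm_of_nonneg (norm_nonneg x), Real.norm_eq_abs]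
    exact ENNReal.one_lt_ofReal.2 hx'

theorem lintegral_rpow_neg_gaussianReal_le {a : ℝ} (ha : 0 < a) (μ : ℝ) {v : NNReal}
    (hv : v ≠ 0) :
    ∫⁻ x, ‖x‖ₑ ^ (-a) ∂(gaussianReal μ v)
      ≤ (v : ℝ≥0∞) ^ (-a / 2) * ((∫⁻ x in Set.Icc (-1 : ℝ) 1, ‖x‖ₑ ^ (-a)) + 1) := by
  have hs : √(v : ℝ) ≠ 0 := by positivity
  have h := gaussianReal_map_const_mul (μ := μ / √v) (v := 1) (√v)
  have hμ : √(v : ℝ) * (μ / √v) = μ := by field_simp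
  have hv' : NNReal.mk (√(v : ℝ) ^ 2) (sq_nonneg _) * 1 = v := by
    ext
    simp
  rw [hμ, hv'] at h
  rw [← h, lintegral_map (by fun_prop) (by fun_prop)]
  have he : ‖√(v : ℝ)‖ₑ = (v : ℝ≥0∞) ^ (1 / 2 : ℝ) := by
    rw [Real.enorm_of_nonneg (Real.sqrt_nonneg _), Real.sqrt_eq_rpow,
      ← ENNReal.ofReal_rpow_of_pos (by positivity), ENNReal.ofReal_coe_nnreal]
  have hm : ∀ x : ℝ, ‖√(v : ℝ) * x‖ₑ ^ (-a) = (v : ℝ≥0∞) ^ (-a / 2) * ‖x‖ₑ ^ (-a) := by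
    intro x
    rw [enorm_mul, ENNReal.mul_rpow_of_ne_top enorm_ne_top enorm_ne_top, he, ← ENNReal.rpow_mul]
    congr 2
    ring
  simp_rw [hm]
  rw [lintegral_const_mul _ (by fun_prop)]
  gcongr
  exact lintegral_rpow_neg_gaussianReal_one_le ha _

variable {p q : ℕ}

/-- At t, the characteristic function of sᵀX is that of X at the tensor s ⊗ t; the Kronecker
covariance makes it factor over the columns. -/
theorem map_combination_multivariateGaussian {Sigma : Matrix (Fin p) (Fin p) ℝ}
    (hS : Sigma.PosSemidef) (μ : EuclideanSpace ℝ (Fin p × Fin q)) (s : Fin p → ℝ) :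
    (multivariateGaussian μ (Sigma ⊗ₖ (1 : Matrix (Fin q) (Fin q) ℝ))).map
        (fun x j => ∑ i, s i * x (i, j))
      = Measure.pi fun j => gaussianReal (∑ i, s i * μ (i, j)) (s ⬝ᵥ Sigma *ᵥ s).toNNReal := by
  have hL : Measurable fun (x : EuclideanSpace ℝ (Fin p × Fin q)) (j : Fin q) =>
      ∑ i, s i * x (i, j) := by fun_prop
  have : IsProbabilityMeasure ((multivariateGaussian μ
      (Sigma ⊗ₖ (1 : Matrix (Fin q) (Fin q) ℝ))).map
        (fun x j => ∑ i, s i * x (i, j))) := Measure.isProbabilityMeasure_map hL.aemeasurable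
  have hv : 0 ≤ s ⬝ᵥ Sigma *ᵥ s := by simpa using hS.dotProduct_mulVec_nonneg s
  refine charFun_eq_pi_iff.1 fun t => ?_
  set u : EuclideanSpace ℝ (Fin p × Fin q) := WithLp.toLp 2 fun ij => s ij.1 * t ij.2
  have h1 : charFun (((multivariateGaussian μ (Sigma ⊗ₖ (1 : Matrix (Fin q) (Fin q) ℝ))).map
        (fun x j => ∑ i, s i * x (i, j))).map (WithLp.toLp 2)) t
      = charFun (multivariateGaussian μ (Sigma ⊗ₖ (1 : Matrix (Fin q) (Fin q) ℝ))) u := by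
    rw [Measure.map_map (by fun_prop) hL, charFun_apply, charFun_apply,
      integral_map (by fun_prop) (by fun_prop)]
    refine integral_congr_ae (ae_of_all _ fun x => ?_)
    have : inner ℝ (WithLp.toLp 2 fun j => ∑ i, s i * x (i, j) : EuclideanSpace ℝ (Fin q)) t
        = inner ℝ x u := by
      simp only [PiLp.inner_apply, RCLike.inner_apply, conj_trivial, u, Fintype.sum_prod_type,
        Finset.mul_sum]
      rw [Finset.sum_comm]
      exact Finset.sum_congr rfl fun _ _ => Finset.sum_congr rfl fun _ _ => by ring
    simp only [Function.comp_apply, this]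
  have h2 : inner ℝ u μ = ∑ j, t j * ∑ i, s i * μ (i, j) := by
    simp only [PiLp.inner_apply, RCLike.inner_apply, conj_trivial, u, Fintype.sum_prod_type,
      Finset.mul_sum]
    rw [Finset.sum_comm]
    exact Finset.sum_congr rfl fun _ _ => Finset.sum_congr rfl fun _ _ => by ring
  have h3 : u ⬝ᵥ (Sigma ⊗ₖ (1 : Matrix (Fin q) (Fin q) ℝ)) *ᵥ u
      = ∑ j, (s ⬝ᵥ Sigma *ᵥ s) * t j ^ 2 := by
    have h4 : ∀ ij : Fin p × Fin q, ((Sigma ⊗ₖ (1 : Matrix (Fin q) (Fin q) ℝ)) *ᵥ u) ij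
        = (Sigma *ᵥ s) ij.1 * t ij.2 := by
      intro ij
      simp only [Matrix.mulVec, dotProduct, Fintype.sum_prod_type, u,
        Finset.sum_mul]
      refine Finset.sum_congr rfl fun k _ => ?_
      simp [Matrix.kroneckerMap_apply, Matrix.one_apply, mul_assoc]
    simp only [dotProduct, h4, Fintype.sum_prod_type, Finset.sum_mul, u]
    rw [Finset.sum_comm]
    exact Finset.sum_congr rfl fun _ _ => Finset.sum_congr rfl fun _ _ => by ring
  rw [h1, charFun_multivariateGaussian (hS.kronecker Matrix.PosSemidef.one), h2, h3]
  simp_rw [charFun_gaussianReal, ← Complex.exp_sum, Real.coe_toNNReal _ hv]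
  congr 1
  push_cast
  rw [Finset.sum_sub_distrib, Finset.sum_mul, Finset.sum_div]

/-- By independence the integral is a product of q factors, each at most v^(-1/q) times a constant,
with v the common variance. The constant is chosen before the covariance, the mean and s, so that s
can later be a random row of S. -/
theorem lintegral_prod_rpow_neg_le (hq : 3 ≤ q) : ∃ C : ℝ≥0∞, C < ∞ ∧
    ∀ {Sigma : Matrix (Fin p) (Fin p) ℝ}, Sigma.PosSemidef →
    ∀ (μ : EuclideanSpace ℝ (Fin p × Fin q)) (s : Fin p → ℝ), 0 < s ⬝ᵥ Sigma *ᵥ s →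
    ∫⁻ x, ∏ j, ‖∑ i, s i * x (i, j)‖ₑ ^ (-(2 / q : ℝ))
        ∂(multivariateGaussian μ (Sigma ⊗ₖ (1 : Matrix (Fin q) (Fin q) ℝ)))
      ≤ (ENNReal.ofReal (s ⬝ᵥ Sigma *ᵥ s))⁻¹ * C := by
  have hq0 : (0 : ℝ) < q := by positivity
  have ha : (2 / q : ℝ) < 1 := by
    rw [div_lt_one hq0]
    exact_mod_cast hq
  set C₀ := (∫⁻ x in Set.Icc (-1 : ℝ) 1, ‖x‖ₑ ^ (-(2 / q : ℝ))) + 1 with hC₀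
  have hC₀' : C₀ < ∞ := ENNReal.add_lt_top.2 ⟨lintegral_Icc_rpow_neg_lt_top ha, by simp⟩
  refine ⟨C₀ ^ q, ENNReal.pow_lt_top hC₀', fun {Sigma} hS μ s hs => ?_⟩
  have hm : Measurable fun y : Fin q → ℝ => ∏ j, ‖y j‖ₑ ^ (-(2 / q : ℝ)) := by fun_prop
  have h1 := lintegral_map (μ := multivariateGaussian μ (Sigma ⊗ₖ (1 : Matrix (Fin q) (Fin q) ℝ)))
    hm (g := fun x j => ∑ i, s i * x (i, j)) (by fun_prop)
  rw [← h1, map_combination_multivariateGaussian hS]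
  have hv : (s ⬝ᵥ Sigma *ᵥ s).toNNReal ≠ 0 := by simpa using hs
  have h2 : ∫⁻ y, ∏ j, ‖y j‖ₑ ^ (-(2 / q : ℝ)) ∂(Measure.pi fun j =>
      gaussianReal (∑ i, s i * μ (i, j)) (s ⬝ᵥ Sigma *ᵥ s).toNNReal)
      = ∏ j, ∫⁻ z, ‖z‖ₑ ^ (-(2 / q : ℝ))
        ∂(gaussianReal (∑ i, s i * μ (i, j)) (s ⬝ᵥ Sigma *ᵥ s).toNNReal) := by
    rw [lintegral_prod_eq_prod_lintegral_of_indepFun Finset.univ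
      (fun j (y : Fin q → ℝ) => ‖y j‖ₑ ^ (-(2 / q : ℝ)))
      (iIndepFun_pi (X := fun _ (z : ℝ) => ‖z‖ₑ ^ (-(2 / q : ℝ))) (fun j => by fun_prop))
      (fun j => by fun_prop)]
    refine Finset.prod_congr rfl fun j _ => ?_
    exact (measurePreserving_eval (fun j => gaussianReal (∑ i, s i * μ (i, j))
      (s ⬝ᵥ Sigma *ᵥ s).toNNReal) j).lintegral_comp
      (f := fun z : ℝ => ‖z‖ₑ ^ (-(2 / q : ℝ))) (by fun_prop)
  rw [h2]
  refine (Finset.prod_le_prod' fun j _ =>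
    lintegral_rpow_neg_gaussianReal_le (by positivity) _ hv).trans (le_of_eq ?_)
  rw [Finset.prod_const, Finset.card_univ, Fintype.card_fin, mul_pow, ← hC₀]
  congr 1
  rw [← ENNReal.rpow_natCast, ← ENNReal.rpow_mul]
  have : -(2 / q : ℝ) / 2 * q = -1 := by field_simp
  rw [this, ENNReal.rpow_neg_one]
  rfl

end moments

/-! ### Null sets of nondegenerate Gaussian measures -/

theorem Matrix.PosDef.exists_pos_mul_dotProduct_self_le {ι : Type*} [Fintype ι] [DecidableEq ι]
    {V : Matrix ι ι ℝ} (hV : V.PosDef) :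
    ∃ c : ℝ, 0 < c ∧ ∀ x : ι → ℝ, c * (x ⬝ᵥ x) ≤ x ⬝ᵥ V *ᵥ x := by
  rcases isEmpty_or_nonempty ι with hι | hι
  · exact ⟨1, one_pos, fun x => by simp⟩
  open scoped MatrixOrder in
  obtain ⟨c, hc, h⟩ := (CFC.exists_pos_algebraMap_le_iff (a := V) hV.isHermitian).2
    fun x hx => hV.isStrictlyPositive.spectrum_pos hx
  refine ⟨c, hc, fun x => ?_⟩
  have h2 := (Matrix.le_iff.1 h).dotProduct_mulVec_nonneg x
  simp [Algebra.algebraMap_eq_smul_one, Matrix.sub_mulVec, Matrix.smul_mulVec, dotProduct_sub] at h2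
  exact h2

section null

variable {ι : Type*} [Fintype ι] [DecidableEq ι]

/-- Splits off an independent one-dimensional Gaussian in the direction u. -/
theorem multivariateGaussian_eq_conv (μ : EuclideanSpace ℝ ι) {V : Matrix ι ι ℝ}
    (u : EuclideanSpace ℝ ι) (hV : V.PosSemidef)
    (hVu : (V - Matrix.vecMulVec u u).PosSemidef) :
    multivariateGaussian μ V = (multivariateGaussian μ (V - Matrix.vecMulVec u u)).conv
      ((gaussianReal 0 1).map fun t : ℝ => t • u) := by
  have hm : Measurable fun t : ℝ => t • u := by fun_prop
  have : IsProbabilityMeasure ((gaussianReal 0 1).map fun t : ℝ => t • u) :=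
    Measure.isProbabilityMeasure_map hm.aemeasurable
  refine Measure.ext_of_charFun (funext fun t => ?_)
  have h1 : charFun ((gaussianReal 0 1).map fun t : ℝ => t • u) t
      = charFun (gaussianReal 0 1) (inner ℝ u t) := by
    rw [charFun_apply, charFun_apply_real, integral_map hm.aemeasurable (by fun_prop)]
    refine integral_congr_ae (ae_of_all _ fun s => ?_)
    simp only [inner_smul_left, conj_trivial]
    push_cast
    ring_nf
  have h2 : t ⬝ᵥ (V - Matrix.vecMulVec u u) *ᵥ t = t ⬝ᵥ V *ᵥ t - (inner ℝ u t) ^ 2 := by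
    have h3 : inner ℝ u t = t ⬝ᵥ u := by
      simp [EuclideanSpace.inner_eq_star_dotProduct]
    rw [Matrix.sub_mulVec, dotProduct_sub, Matrix.vecMulVec_mulVec, h3, sq]
    simp [dotProduct_comm]
  rw [charFun_conv, charFun_multivariateGaussian hV, charFun_multivariateGaussian hVu, h1,
    charFun_gaussianReal, ← Complex.exp_add, h2]
  congr 1
  push_cast
  ring

/-- By Fubini, after splitting off a Gaussian along a small multiple of u: each line meets s in a
countable set, which the one-dimensional Gaussian does not charge. -/
theorem multivariateGaussian_eq_zero_of_countable_line (μ : EuclideanSpace ℝ ι)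
    {V : Matrix ι ι ℝ} (hV : V.PosDef) {s : Set (EuclideanSpace ℝ ι)} (hs : MeasurableSet s)
    (u : EuclideanSpace ℝ ι) (h : ∀ x, {t : ℝ | x + t • u ∈ s}.Countable) :
    multivariateGaussian μ V s = 0 := by
  obtain ⟨c, hc, hcV⟩ := hV.exists_pos_mul_dotProduct_self_le
  -- Small enough to keep V - d²uuᵀ positive semidefinite; the summand 1 covers u = 0.
  set d : ℝ := √(c / (‖u‖ ^ 2 + 1))
  have hd : d ≠ 0 := by positivity
  have hd2 : d ^ 2 * ‖u‖ ^ 2 ≤ c := by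
    rw [Real.sq_sqrt (by positivity), div_mul_eq_mul_div, div_le_iff₀ (by positivity)]
    nlinarith
  have hVu : (V - Matrix.vecMulVec (d • u) (d • u)).PosSemidef := by
    refine Matrix.PosSemidef.of_dotProduct_mulVec_nonneg ?_ fun x => ?_
    · refine hV.isHermitian.sub ?_
      rw [Matrix.IsHermitian, Matrix.conjTranspose_eq_transpose_of_trivial,
        Matrix.transpose_vecMulVec]
    · have h1 := hcV x
      have h2 : (u ⬝ᵥ x) ^ 2 ≤ ‖u‖ ^ 2 * (x ⬝ᵥ x) := by
        rw [EuclideanSpace.real_norm_sq_eq]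
        simp only [dotProduct, ← sq]
        exact Finset.sum_mul_sq_le_sq_mul_sq _ _ _
      have hx : 0 ≤ x ⬝ᵥ x := by simpa using dotProduct_star_self_nonneg x
      rw [Matrix.sub_mulVec, dotProduct_sub, Matrix.vecMulVec_mulVec]
      have h3 : star x ⬝ᵥ MulOpposite.op ((d • u).ofLp ⬝ᵥ x) • (d • u).ofLp
          = d ^ 2 * (u ⬝ᵥ x) ^ 2 := by
        simp [dotProduct_comm x]
        ring
      rw [h3, sub_nonneg, star_trivial]
      calc d ^ 2 * (u ⬝ᵥ x) ^ 2 ≤ d ^ 2 * (‖u‖ ^ 2 * (x ⬝ᵥ x)) := by gcongr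
        _ = d ^ 2 * ‖u‖ ^ 2 * (x ⬝ᵥ x) := by ring
        _ ≤ c * (x ⬝ᵥ x) := by gcongr
        _ ≤ _ := h1
  rw [multivariateGaussian_eq_conv μ (d • u) hV.posSemidef hVu]
  rw [← lintegral_indicator_one hs, Measure.lintegral_conv (measurable_one.indicator hs)]
  refine (lintegral_congr fun x => ?_).trans lintegral_zero
  have hmx : Measurable fun t : ℝ => x + t • d • u := by fun_prop
  have h0 : gaussianReal 0 1 ((fun t : ℝ => x + t • d • u) ⁻¹' s) = 0 := by
    have := nullSingletonClass_gaussianReal (μ := 0) (v := 1) one_ne_zero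
    refine Set.Countable.measure_zero ?_ _
    refine ((h x).preimage (f := fun t => t * d) (mul_left_injective₀ hd)).mono fun t ht => ?_
    simpa [mul_smul] using ht
  have hg : Measurable fun y => s.indicator (1 : EuclideanSpace ℝ ι → ENNReal) (x + y) :=
    (measurable_one.indicator hs).comp (measurable_const_add x)
  rw [lintegral_map hg (by fun_prop), ← h0, ← lintegral_indicator_one (hmx hs)]
  rfl

end null

/-! ### Almost sure properties of a nondegenerate matrix normal variable -/

section ae

variable {m n : Type*} [Fintype m] [Fintype n] [DecidableEq m] [DecidableEq n]

omit [DecidableEq m] in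
-- In the reciprocal parameter 1/t the Gram determinant is, up to a power of t, a polynomial whose
-- value at 0 is det(UᵀU) ≠ 0. The point t = 0 is added separately.
theorem finite_setOf_det_gram_line_eq_zero (W U : Matrix m n ℝ) (hU : (Uᵀ * U).det ≠ 0) :
    {t : ℝ | ((W + t • U)ᵀ * (W + t • U)).det = 0}.Finite := by
  set N : Matrix m n (Polynomial ℝ) := U.map Polynomial.C + (Polynomial.X : Polynomial ℝ) •
    W.map Polynomial.C
  have hN : ∀ u : ℝ, N.map (Polynomial.evalRingHom u) = U + u • W := by
    intro u
    ext i j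
    simp [N, mul_comm (W i j)]
  have hev : ∀ u : ℝ, (Nᵀ * N).det.eval u = ((U + u • W)ᵀ * (U + u • W)).det := by
    intro u
    rw [← Polynomial.coe_evalRingHom, RingHom.map_det, RingHom.mapMatrix_apply, Matrix.map_mul,
      Matrix.transpose_map, hN]
  have h0 : (Nᵀ * N).det ≠ 0 := by
    intro h
    have := hev 0
    rw [h] at this
    exact hU (by simpa using this.symm)
  have hfin : {u : ℝ | (Nᵀ * N).det.IsRoot u}.Finite := Polynomial.finite_setOfPred_isRoot h0
  refine ((hfin.preimage (f := fun t : ℝ => t⁻¹) inv_injective.injOn).union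
    (Set.finite_singleton 0)).subset fun t ht => ?_
  rcases eq_or_ne t 0 with h | h
  · exact Or.inr h
  · left
    have h1 : W + t • U = t • (U + t⁻¹ • W) := by
      rw [smul_add, smul_smul, mul_inv_cancel₀ h, one_smul, add_comm]
    rw [Set.mem_ofPred_eq, h1, Matrix.transpose_smul, Matrix.smul_mul, Matrix.mul_smul, smul_smul,
      Matrix.det_smul] at ht
    rw [Set.mem_preimage, Set.mem_ofPred_eq, Polynomial.IsRoot, hev]
    exact (mul_eq_zero.1 ht).resolve_left (by positivity)

omit [Fintype m] [Fintype n] [DecidableEq m] [DecidableEq n] in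
theorem continuous_matrix_of_entries : Continuous fun x : EuclideanSpace ℝ (m × n) =>
    (Matrix.of fun i j => x (i, j) : Matrix m n ℝ) :=
  continuous_matrix fun i j => by
    simp only [Matrix.of_apply]
    fun_prop

theorem IsMatrixNormal.ae_ne_zero {Ω : Type*} [MeasurableSpace Ω] {P : Measure Ω}
    {Z : Ω → Matrix m n ℝ} {M : Matrix m n ℝ} {V : Matrix m m ℝ} {W : Matrix n n ℝ}
    (hZ : IsMatrixNormal P Z M V W) (hV : V.PosDef) (hW : W.PosDef) {f : Matrix m n ℝ → ℝ}
    (hf : Continuous fun x : EuclideanSpace ℝ (m × n) => f (Matrix.of fun i j => x (i, j)))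
    (U : Matrix m n ℝ) (h : ∀ W, {t : ℝ | f (W + t • U) = 0}.Countable) :
    ∀ᵐ ω ∂P, f (Z ω) ≠ 0 := by
  have hs : MeasurableSet {x : EuclideanSpace ℝ (m × n) | f (Matrix.of fun i j => x (i, j)) = 0} :=
    hf.measurable (measurableSet_singleton 0)
  have h0 := multivariateGaussian_eq_zero_of_countable_line (entryVec M) (hV.kronecker hW) hs
    (entryVec U) fun x => h (Matrix.of fun i j => x (i, j))
  rw [← hZ.map_eq, Measure.map_apply_of_aemeasurable hZ.aemeasurable hs] at h0
  exact measure_eq_zero_iff_ae_notMem.1 h0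

theorem IsMatrixNormal.entryAEMeasurable {Ω : Type*} [MeasurableSpace Ω] {P : Measure Ω}
    {Z : Ω → Matrix m n ℝ} {M : Matrix m n ℝ} {V : Matrix m m ℝ} {W : Matrix n n ℝ}
    (hZ : IsMatrixNormal P Z M V W) : EntryAEMeasurable Z P := fun i j =>
  (show Measurable fun x : EuclideanSpace ℝ (m × n) => x (i, j) by fun_prop).comp_aemeasurable
    hZ.aemeasurable

theorem IsMatrixNormal.integrable_sq {Ω : Type*} [MeasurableSpace Ω] {P : Measure Ω}
    {Z : Ω → Matrix m n ℝ} {M : Matrix m n ℝ} {V : Matrix m m ℝ} {W : Matrix n n ℝ}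
    (hZ : IsMatrixNormal P Z M V W) (i : m) (j : n) : Integrable (fun ω => Z ω i j ^ 2) P := by
  have h1 := (IsGaussian.memLp_dual (multivariateGaussian (entryVec M) (V ⊗ₖ W))
    (EuclideanSpace.proj (𝕜 := ℝ) (i, j)) 2 (by simp)).integrable_sq
  rw [← hZ.map_eq] at h1
  exact h1.comp_aemeasurable hZ.aemeasurable

/-- The direction consists of distinct columns of the identity, chosen by f, so its Gram matrix is
1. -/
theorem IsMatrixNormal.ae_det_gram_ne_zero {Ω : Type*} [MeasurableSpace Ω] {P : Measure Ω}
    {Z : Ω → Matrix m n ℝ} {M : Matrix m n ℝ} {V : Matrix m m ℝ} {W : Matrix n n ℝ}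
    (hZ : IsMatrixNormal P Z M V W) (hV : V.PosDef) (hW : W.PosDef) (f : n ↪ m) :
    ∀ᵐ ω ∂P, ((Z ω)ᵀ * Z ω).det ≠ 0 := by
  refine hZ.ae_ne_zero hV hW (f := fun M => (Mᵀ * M).det) ?_
    ((1 : Matrix m m ℝ).submatrix id f) fun W => ?_
  · have h := continuous_matrix_of_entries (m := m) (n := n)
    exact (h.matrix_transpose.matrix_mul h).matrix_det
  · refine (finite_setOf_det_gram_line_eq_zero W _ ?_).countable
    rw [Matrix.transpose_submatrix, Matrix.transpose_one,
      ← Matrix.submatrix_mul _ _ _ _ _ Function.bijective_id, Matrix.one_mul,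
      Matrix.submatrix_one _ f.injective, Matrix.det_one]
    exact one_ne_zero

theorem IsMatrixNormal.ae_det_mul_transpose_ne_zero {Ω : Type*} [MeasurableSpace Ω]
    {P : Measure Ω} {Z : Ω → Matrix m n ℝ} {M : Matrix m n ℝ} {V : Matrix m m ℝ}
    {W : Matrix n n ℝ} (hZ : IsMatrixNormal P Z M V W) (hV : V.PosDef) (hW : W.PosDef)
    (f : m ↪ n) : ∀ᵐ ω ∂P, (Z ω * (Z ω)ᵀ).det ≠ 0 := by
  refine hZ.ae_ne_zero hV hW (f := fun M => (M * Mᵀ).det) ?_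
    ((1 : Matrix n n ℝ).submatrix f id) fun W => ?_
  · have h := continuous_matrix_of_entries (m := m) (n := n)
    exact (h.matrix_mul h.matrix_transpose).matrix_det
  · have h := (finite_setOf_det_gram_line_eq_zero Wᵀ ((1 : Matrix n n ℝ).submatrix id f)
      ?_).countable
    · have h1 : ((1 : Matrix n n ℝ).submatrix f id)ᵀ = (1 : Matrix n n ℝ).submatrix id f := by
        rw [Matrix.transpose_submatrix, Matrix.transpose_one]
      simpa [← h1, ← Matrix.transpose_smul, ← Matrix.transpose_add, -Matrix.transpose_submatrix]
        using h
    rw [Matrix.transpose_submatrix, Matrix.transpose_one,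
      ← Matrix.submatrix_mul _ _ _ _ _ Function.bijective_id, Matrix.one_mul,
      Matrix.submatrix_one _ f.injective, Matrix.det_one]
    exact one_ne_zero

theorem IsMatrixNormal.ae_apply_ne_zero {Ω : Type*} [MeasurableSpace Ω]
    {P : Measure Ω} {Z : Ω → Matrix m n ℝ} {M : Matrix m n ℝ} {V : Matrix m m ℝ}
    {W : Matrix n n ℝ} (hZ : IsMatrixNormal P Z M V W) (hV : V.PosDef) (hW : W.PosDef)
    (i : m) (j : n) : ∀ᵐ ω ∂P, Z ω i j ≠ 0 := by
  refine hZ.ae_ne_zero hV hW (f := fun M => M i j) (by simp only [Matrix.of_apply]; fun_prop)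
    (Matrix.single i j 1) fun W => ?_
  refine (Set.countable_singleton (-W i j)).mono fun t ht => ?_
  have h : W i j + t = 0 := by simpa using ht
  exact Set.mem_singleton_iff.2 (by linarith)

end ae

/-! ### Integrability of `1 / F` -/

section inverseMoment

open scoped ENNReal

variable {p q : ℕ}

/-- Each xⱼ² is at most the sum of squares; take the power -1/q and multiply over j. -/
theorem inv_sum_sq_le_prod_rpow (hq : 0 < q) (x : Fin q → ℝ) :
    (ENNReal.ofReal (∑ j, x j ^ 2))⁻¹ ≤ ∏ j, ‖x j‖ₑ ^ (-(2 / q : ℝ)) := by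
  have hq0 : (0 : ℝ) < q := by positivity
  set N := ENNReal.ofReal (∑ j, x j ^ 2)
  have h1 : ∀ j, (N ^ (1 / q : ℝ))⁻¹ ≤ ‖x j‖ₑ ^ (-(2 / q : ℝ)) := by
    intro j
    rw [ENNReal.rpow_neg, ENNReal.inv_le_inv,
      show (2 / q : ℝ) = (2 : ℕ) * (1 / q : ℝ) by push_cast; ring, ENNReal.rpow_mul,
      ENNReal.rpow_natCast]
    refine ENNReal.rpow_le_rpow ?_ (by positivity)
    rw [← enorm_norm, Real.enorm_of_nonneg (norm_nonneg _),
      ← ENNReal.ofReal_pow (norm_nonneg _), Real.norm_eq_abs, sq_abs]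
    exact ENNReal.ofReal_le_ofReal (Finset.single_le_sum (f := fun j => x j ^ 2)
      (fun i _ => sq_nonneg (x i)) (Finset.mem_univ j))
  refine le_trans (le_of_eq ?_) (Finset.prod_le_prod' fun j _ => h1 j)
  rw [Finset.prod_const, Finset.card_univ, Fintype.card_fin, ← ENNReal.inv_pow,
    ← ENNReal.rpow_natCast, ← ENNReal.rpow_mul, one_div, inv_mul_cancel₀ hq0.ne',
    ENNReal.rpow_one]

/-- An upper bound for `1 / F` in terms of the entries of `X` and of `S`, using the row `i₀` of
`S`. -/
noncomputable def invFBound (i₀ : Fin p) (x : EuclideanSpace ℝ (Fin p × Fin q))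
    (s : EuclideanSpace ℝ (Fin p × Fin p)) : ℝ≥0∞ :=
  ENNReal.ofReal (∑ k, s (k, k)) * ENNReal.ofReal (∑ k, s (i₀, k) ^ 2)
    * ∏ j, ‖∑ i, s (i₀, i) * x (i, j)‖ₑ ^ (-(2 / q : ℝ))

theorem measurable_invFBound (i₀ : Fin p) :
    Measurable fun z : EuclideanSpace ℝ (Fin p × Fin q) × EuclideanSpace ℝ (Fin p × Fin p) =>
      invFBound i₀ z.1 z.2 := by
  unfold invFBound
  fun_prop

theorem exists_lintegral_invFBound_le (hq : 3 ≤ q) {Sigma : Matrix (Fin p) (Fin p) ℝ}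
    (hS : Sigma.PosDef) (μ : EuclideanSpace ℝ (Fin p × Fin q)) (i₀ : Fin p) :
    ∃ C : ℝ≥0∞, C < ∞ ∧ ∀ s,
      ∫⁻ x, invFBound i₀ x s
          ∂(multivariateGaussian μ (Sigma ⊗ₖ (1 : Matrix (Fin q) (Fin q) ℝ)))
        ≤ C * ENNReal.ofReal (∑ k, s (k, k)) := by
  obtain ⟨C, hC, h⟩ := lintegral_prod_rpow_neg_le (p := p) hq
  obtain ⟨c, hc, hcS⟩ := hS.exists_pos_mul_dotProduct_self_le
  refine ⟨ENNReal.ofReal c⁻¹ * C, ENNReal.mul_lt_top ENNReal.ofReal_lt_top hC, fun s => ?_⟩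
  unfold invFBound
  rw [lintegral_const_mul _ (by fun_prop)]
  set u : Fin p → ℝ := fun k => s (i₀, k)
  have hu : ∑ k, s (i₀, k) ^ 2 = u ⬝ᵥ u := by simp only [dotProduct, sq, u]
  rw [hu, mul_assoc, mul_comm]
  refine mul_le_mul_left ?_ _
  -- A zero row makes the prefactor vanish. Otherwise u·u cancels against the variance, which is at
  -- least c(u·u).
  rcases eq_or_ne u 0 with h0 | h0
  · simp [h0]
  have hpos : 0 < u ⬝ᵥ u := by
    simpa using Matrix.dotProduct_star_self_pos_iff.2 h0
  have hv : 0 < u ⬝ᵥ Sigma *ᵥ u := lt_of_lt_of_le (by positivity) (hcS u)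
  refine (mul_le_mul_right (h hS.posSemidef μ u hv) _).trans ?_
  rw [← mul_assoc, ← ENNReal.ofReal_inv_of_pos hv, ← ENNReal.ofReal_mul hpos.le]
  gcongr
  rw [← div_eq_mul_inv, div_le_iff₀ hv, inv_mul_eq_div, le_div_iff₀ hc, mul_comm]
  exact hcS u

end inverseMoment

theorem ofReal_inv_normF_le_invFBound {m : Type*} [Fintype m] {p q : ℕ} (hq : 0 < q)
    {X : Matrix (Fin p) (Fin q) ℝ} {Y : Matrix m (Fin p) ℝ} {a₀ : m} {i₀ : Fin p}
    (h₀ : Y a₀ i₀ ≠ 0) (hfin : invFBound i₀ (entryVec X) (entryVec (Yᵀ * Y)) < ⊤) :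
    normF X Y ≠ 0 ∧
      ENNReal.ofReal (normF X Y)⁻¹ ≤ invFBound i₀ (entryVec X) (entryVec (Yᵀ * Y)) := by
  have hrow := sum_sq_row_le X Y i₀
  have hb : ENNReal.ofReal (Yᵀ * Y).trace * ENNReal.ofReal (∑ k, (Yᵀ * Y) i₀ k ^ 2)
        * (ENNReal.ofReal (∑ j, (Yᵀ * Y * X) i₀ j ^ 2))⁻¹
      ≤ invFBound i₀ (entryVec X) (entryVec (Yᵀ * Y)) :=
    mul_le_mul_right (inv_sum_sq_le_prod_rpow hq _) _
  have hS0 : 0 < (Yᵀ * Y) i₀ i₀ := by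
    simp only [Matrix.mul_apply, Matrix.transpose_apply, ← sq]
    exact Finset.sum_pos' (fun a _ => sq_nonneg _) ⟨a₀, Finset.mem_univ _, by positivity⟩
  have htr : 0 < (Yᵀ * Y).trace := by
    refine Finset.sum_pos' (fun k _ => ?_) ⟨i₀, Finset.mem_univ _, hS0⟩
    simp only [Matrix.diag_apply, Matrix.mul_apply, Matrix.transpose_apply, ← sq]
    positivity
  have hs : 0 < ∑ k, (Yᵀ * Y) i₀ k ^ 2 :=
    Finset.sum_pos' (fun k _ => sq_nonneg _) ⟨i₀, Finset.mem_univ _, by positivity⟩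
  have hN0 : 0 ≤ ∑ j, (Yᵀ * Y * X) i₀ j ^ 2 := Finset.sum_nonneg fun j _ => sq_nonneg _
  generalize (Yᵀ * Y).trace = T at *
  generalize ∑ k, (Yᵀ * Y) i₀ k ^ 2 = s at *
  generalize ∑ j, (Yᵀ * Y * X) i₀ j ^ 2 = N at *
  -- If N were 0, the finite bound would dominate a positive number times ⊤.
  have hN : 0 < N := by
    refine lt_of_le_of_ne hN0 fun hN => ?_
    rw [← hN, ENNReal.ofReal_zero, ENNReal.inv_zero, ENNReal.mul_top] at hb
    · exact hfin.not_ge hb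
    · exact mul_ne_zero (ENNReal.ofReal_pos.2 htr).ne' (ENNReal.ofReal_pos.2 hs).ne'
  have hF0 : 0 < normF X Y := by
    refine lt_of_le_of_ne (normF_nonneg _ _) fun hF => ?_
    rw [← hF, mul_zero, mul_zero] at hrow
    exact hN.not_ge hrow
  refine ⟨hF0.ne', le_trans ?_ hb⟩
  rw [← ENNReal.ofReal_mul htr.le, ← ENNReal.ofReal_inv_of_pos hN,
    ← ENNReal.ofReal_mul (by positivity)]
  refine ENNReal.ofReal_le_ofReal ?_
  rw [← div_eq_mul_inv, inv_le_comm₀ hF0 (by positivity), inv_div, div_le_iff₀ (by positivity)]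
  linarith

theorem EntryAEMeasurable.entryVec {Ω m n : Type*} [MeasurableSpace Ω] [Countable m]
    [Countable n] {P : Measure Ω}
    {M : Ω → Matrix m n ℝ} (h : EntryAEMeasurable M P) :
    AEMeasurable (fun ω => entryVec (M ω)) P :=
  (WithLp.measurable_toLp 2 _).comp_aemeasurable
    (aemeasurable_pi_lambda _ fun ij : m × n => h ij.1 ij.2)

/-- Independence makes the law of (X, S) a product. Integrating over X first leaves a constant times
E[tr S]. -/
theorem lintegral_invFBound_lt_top {Ω m : Type*} [MeasurableSpace Ω] {P : Measure Ω}
    [IsProbabilityMeasure P] [Fintype m] {p q : ℕ} (hq : 3 ≤ q)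
    {θ : Matrix (Fin p) (Fin q) ℝ} {Sigma : Matrix (Fin p) (Fin p) ℝ} (hSigma : Sigma.PosDef)
    {X : Ω → Matrix (Fin p) (Fin q) ℝ} {Y : Ω → Matrix m (Fin p) ℝ}
    (hX : IsMatrixNormal P X θ Sigma 1) (hY : EntryAEMeasurable Y P)
    (hY2 : ∀ a i, Integrable (fun ω => Y ω a i ^ 2) P)
    (hXS : IndepFun (fun ω => entryVec (X ω)) (fun ω => entryVec ((Y ω)ᵀ * Y ω)) P)
    (i₀ : Fin p) :
    ∫⁻ ω, invFBound i₀ (entryVec (X ω)) (entryVec ((Y ω)ᵀ * Y ω)) ∂P < ⊤ := by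
  have hSv := (hY.transpose.mul hY).entryVec
  have hlaw := hXS.map_prod_eq_prod_map_map hX.aemeasurable hSv
  rw [hX.map_eq] at hlaw
  obtain ⟨C, hC, hCb⟩ := exists_lintegral_invFBound_le hq hSigma (entryVec θ) i₀
  have h1 := lintegral_map' (μ := P) (measurable_invFBound (q := q) i₀).aemeasurable
    (hX.aemeasurable.prodMk hSv)
  rw [← h1, hlaw, lintegral_prod_symm' _ (measurable_invFBound i₀)]
  refine (lintegral_mono hCb).trans_lt ?_
  rw [lintegral_const_mul _ (by fun_prop), lintegral_map' (by fun_prop) hSv]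
  refine ENNReal.mul_lt_top hC ?_
  have h2 : Integrable (fun ω => ∑ k, ((Y ω)ᵀ * Y ω) k k) P := by
    simp only [Matrix.mul_apply, Matrix.transpose_apply, ← sq]
    exact integrable_finsetSum _ fun k _ => integrable_finsetSum _ fun a _ => hY2 a k
  exact h2.lintegral_lt_top

theorem ae_normF_ne_zero_and_integrable_inv {Ω m : Type*} [MeasurableSpace Ω] {P : Measure Ω}
    [IsProbabilityMeasure P] [Fintype m] {p q : ℕ} (hq : 3 ≤ q)
    {θ : Matrix (Fin p) (Fin q) ℝ} {Sigma : Matrix (Fin p) (Fin p) ℝ} (hSigma : Sigma.PosDef)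
    {X : Ω → Matrix (Fin p) (Fin q) ℝ} {Y : Ω → Matrix m (Fin p) ℝ}
    (hX : IsMatrixNormal P X θ Sigma 1) (hY : EntryAEMeasurable Y P)
    (hY2 : ∀ a i, Integrable (fun ω => Y ω a i ^ 2) P)
    (hXS : IndepFun (fun ω => entryVec (X ω)) (fun ω => entryVec ((Y ω)ᵀ * Y ω)) P)
    {a₀ : m} {i₀ : Fin p} (h₀ : ∀ᵐ ω ∂P, Y ω a₀ i₀ ≠ 0)
    (hF : AEMeasurable (fun ω => normF (X ω) (Y ω)) P) :
    (∀ᵐ ω ∂P, normF (X ω) (Y ω) ≠ 0) ∧ Integrable (fun ω => (normF (X ω) (Y ω))⁻¹) P := by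
  have hfin := lintegral_invFBound_lt_top hq hSigma hX hY hY2 hXS i₀
  have hSv := (hY.transpose.mul hY).entryVec
  have hm : AEMeasurable
      (fun ω => invFBound i₀ (entryVec (X ω)) (entryVec ((Y ω)ᵀ * Y ω))) P := by
    have h1 := (measurable_invFBound (q := q) i₀).comp_aemeasurable
      (hX.entryAEMeasurable.entryVec.prodMk hSv)
    exact h1
  have hae : ∀ᵐ ω ∂P, invFBound i₀ (entryVec (X ω)) (entryVec ((Y ω)ᵀ * Y ω)) < ⊤ :=
    ae_lt_top' hm hfin.ne
  have key : ∀ᵐ ω ∂P, normF (X ω) (Y ω) ≠ 0 ∧ ENNReal.ofReal (normF (X ω) (Y ω))⁻¹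
      ≤ invFBound i₀ (entryVec (X ω)) (entryVec ((Y ω)ᵀ * Y ω)) := by
    filter_upwards [hae, h₀] with ω hω h0
    exact ofReal_inv_normF_le_invFBound (by omega) h0 hω
  refine ⟨key.mono fun ω h => h.1, ⟨hF.inv.aestronglyMeasurable, ?_⟩⟩
  have hle : ∫⁻ ω, ‖(normF (X ω) (Y ω))⁻¹‖ₑ ∂P
      ≤ ∫⁻ ω, invFBound i₀ (entryVec (X ω)) (entryVec ((Y ω)ᵀ * Y ω)) ∂P := by
    refine lintegral_mono_ae (key.mono fun ω h => ?_)
    rw [Real.enorm_of_nonneg (inv_nonneg.2 (normF_nonneg _ _))]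
    exact h.2
  exact hle.trans_lt hfin

/-! ### Assembly of the theorem -/

theorem mainTheorem7 {Ω : Type*} [MeasurableSpace Ω] (P : Measure Ω) [IsProbabilityMeasure P]
    (n p q : ℕ) (hn : 0 < n) (hp : 0 < p) (hq : 3 ≤ q)
    (θ : Matrix (Fin p) (Fin q) ℝ)
    (Sigma A : Matrix (Fin p) (Fin p) ℝ) (hSigma : Sigma.PosDef)
    (hA : A.PosDef) (hAS : A * A = Sigma)
    (X : Ω → Matrix (Fin p) (Fin q) ℝ) (Y : Ω → Matrix (Fin (n * q)) (Fin p) ℝ)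
    (hX : IsMatrixNormal P X θ Sigma 1)
    (hY : IsMatrixNormal P Y 0 1 ((q : ℝ)⁻¹ • Sigma))
    (hXS : IndepFun (fun ω => entryVec (X ω)) (fun ω => entryVec ((Y ω)ᵀ * Y ω)) P)
    (r : ℝ → ℝ) (c₁ c₂ : ℝ) (hr : ∀ t, 0 ≤ r t ∧ r t ≤ c₁)
    (hrd : Differentiable ℝ r) (hr' : ∀ t, |deriv r t| ≤ c₂) :
    (∀ᵐ ω ∂P, 2 < q * ((Y ω)ᵀ * Y ω).rank) ∧
    (∀ᵐ ω ∂P, HasDivAt (fieldYH r A (X ω)) (tildeY q A (Y ω))) ∧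
    Integrable (fun ω => matDiv (fieldYH r A (X ω)) (tildeY q A (Y ω))) P := by
  have hq0 : 0 < q := by omega
  have hW : ((q : ℝ)⁻¹ • Sigma).PosDef := hSigma.smul (by positivity)
  have hV : (1 : Matrix (Fin (n * q)) (Fin (n * q)) ℝ).PosDef := Matrix.PosDef.one
  have hXm := hX.entryAEMeasurable
  have hYm := hY.entryAEMeasurable
  have h₀ := hY.ae_apply_ne_zero hV hW ⟨0, Nat.mul_pos hn hq0⟩ ⟨0, hp⟩
  -- The rank is almost surely the constant min(p, nq). In both cases the explicit formula for Y⁺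
  -- also supplies its measurability.
  obtain ⟨ρ, hpm, hfull⟩ : ∃ ρ : ℝ, EntryAEMeasurable (fun ω => pinv (Y ω)) P ∧
      ∀ᵐ ω ∂P, FullRank (Y ω) ∧ (pinv (Y ω) * Y ω).trace = ρ := by
    rcases le_total p (n * q) with h | h
    · have hdet := hY.ae_det_gram_ne_zero hV hW (Fin.castLEEmb h)
      refine ⟨_, ?_, hdet.mono fun ω hω => ⟨Or.inl hω, trace_pinv_mul_of_det_ne_zero hω⟩⟩
      exact ((hYm.transpose.mul hYm).inv.mul hYm.transpose).congr
        (hdet.mono fun ω hω => (pinv_eq_of_det_ne_zero hω).symm)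
    · have hdet := hY.ae_det_mul_transpose_ne_zero hV hW (Fin.castLEEmb h)
      refine ⟨_, ?_, hdet.mono fun ω hω => ⟨Or.inr hω, trace_pinv_mul_of_det_ne_zero' hω⟩⟩
      exact (hYm.transpose.mul (hYm.mul hYm.transpose).inv).congr
        (hdet.mono fun ω hω => (pinv_eq_of_det_ne_zero' hω).symm)
  have hVm : EntryAEMeasurable (fun ω => matV (X ω) (Y ω)) P := hpm.transpose.mul hXm
  obtain ⟨hF, hFi⟩ := ae_normF_ne_zero_and_integrable_inv hq hSigma hX hYm hY.integrable_sq hXS h₀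
    (hVm.transpose.mul hVm).trace
  refine ⟨?_, ?_, ?_⟩
  -- One nonzero entry of Y gives rank at least 1, and q ≥ 3 does the rest.
  · filter_upwards [h₀] with ω hω
    have h1 : ((Y ω)ᵀ * Y ω).rank ≠ 0 := by
      intro h
      rw [Matrix.rank_transpose_mul_self, Matrix.rank, Submodule.finrank_eq_zero,
        LinearMap.range_eq_bot] at h
      have h2 := congrFun (LinearMap.congr_fun h (Pi.single ⟨0, hp⟩ 1)) ⟨0, Nat.mul_pos hn hq0⟩
      exact hω (by simpa using h2)
    have h2 : 1 ≤ ((Y ω)ᵀ * Y ω).rank := Nat.one_le_iff_ne_zero.2 h1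
    nlinarith
  · filter_upwards [hfull, hF] with ω h1 h2
    exact hasDivAt_fieldYH hq0 hrd hA h1.1 h2
  · have hint : Integrable (fun ω => divFormula r ρ (X ω) (Y ω)) P := by
      refine ((hFi.const_mul _).add (integrable_const _)).mono'
        (aemeasurable_divFormula hrd ρ hXm hpm).aestronglyMeasurable
        (hF.mono fun ω h => abs_divFormula_le hr hr' ρ h)
    refine hint.congr ?_
    filter_upwards [hfull, hF] with ω h1 h2
    rw [matDiv_fieldYH hq0 hrd hA h1.1 h2, h1.2]
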